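/- **Setting.** PermitBFT is run by $n$ nodes $0,\dots,n-1$, of which at most $f$ are byzantine, where $3f<n$; the others are honest. Nodes sign their messages and byzantine nodes cannot produce signatures of honest nodes; otherwise they behave arbitrarily. Local computation takes no time. The *creator* of round $r$ is the node $r \bmod n$. A *position* is a finite set of blocks. On starting round $r$, each honest node sends to the creator of round $r$ a signed *permit* for the pair of $r$ and its current position (initially the genesis block in round $0$), and starts its timers. * As soon as the creator of round $r$, being in its creator phase, has permits of round $r$ by $2f+1$ distinct nodes for one position, it sends to all nodes a signed *block* that consists of these permits (the *proof*) and a set of transactions and is appended to that position. If instead its creator timeout occurs, its creator phase ends; if it then has permits of round $r$ by at least $2f+1$ distinct nodes, it sends to all nodes a signed *proposal* consisting of these permits (one per issuer) and of a minimal position that respects all of them. A position *respects* all blocks on paths from the genesis block to the position, and all childless blocks of depth at most the depth of the position minus $2$. * A node in round $r$ that receives a valid block or proposal of a round $r'\ge r$ *accepts* it: it adopts as its current position the new block, or the position of the proposal, and starts round $r'+1$. A creator immediately accepts its own block or proposal. * Whenever its round timeout occurs, a node in round $r$ sends a signed timeout message for round $r$ to all nodes, and the timer restarts. A node in round $r$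 that has timeout messages by $2f+1$ nodes for a round $\ge r$ takes the maximal such round $r'$, sends $2f+1$ of these messages to all other nodes, and starts round $r'+1$ with its current position unchanged. A node that receives a timeout message for a round smaller than its own answers its issuer with the block, the proposal or the $2f+1$ timeout messages through which it entered its present round. A time interval $[a,b]$ is a *period of synchrony* if each message between honest nodes, sent at time $s$, is delivered at the latest at time $\max(s,a)+\Delta$, whenever $\max(s,a)+\Delta\le b$; outside such periods delays are arbitrary, and messages may be received in any order. An honest node *accepts a block $B$ of round $r$ (directly or implicitly)* if, while in a round $\le r$, it accepts $B$ itself, or a block or proposal of a later round whose position confirms $B$. Here the position of a block is the position consisting of that block, and a position *confirms* $B$ if it contains $B$, or contains a block that was appended to a position confirming $B$, or is the position of a proposal accepted by an honest node that contains a permit for a position confirming $B$. **Theorem.** Suppose that for every node $$2\Delta<\text{creator timeout}<3\Delta\qquad\text{and}\qquad 5\Delta<\text{round timeout}.$$ Then there is $L>0$, depending only on $n$, $f$, $\Delta$ and the timeouts, such that in every execution of PermitBFT with at most $f$ byzantine nodes (starting at time $0$, with only finitely many steps in every bounded time interval), for every period of synchrony $[a,b]$ with $a\ge 0$ and every interval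 $[c,c+L]\subseteq[a,b]$: during $[c,c+L]$ some honest creator creates a new valid block $B$, and every honest node accepts $B$ (directly or implicitly) during $[c,c+L]$, before it starts any round after that of $B$ in any other way. -/

import Mathlib

open Filter

universe u

namespace PermitBFT

noncomputable section

/-! ## Blocks, positions, proposals

Nodes are the elements of `Fin n`; `Tx` is the type of transactions. -/

/-- A block is either the genesis block or a tuple `(proof, transactions)`. All permits of a proof
are for one round and one position, so a proof is given by that round, that position (enumerated by
`parent`) and the set `issuers` of the nodes that issued the permits. -/
inductive Block (n : ℕ) (Tx : Type u) : Type u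
  | genesis : Block n Tx
  | mk (round : ℕ) (arity : ℕ) (parent : Fin arity → Block n Tx)
      (issuers : Finset (Fin n)) (txs : Finset Tx) : Block n Tx

/-- A position is a finite set of blocks. -/
abbrev Position (n : ℕ) (Tx : Type u) := Finset (Block n Tx)

namespace Block

variable {n : ℕ} {Tx : Type u}

/-- The round in which a block is created (`0` by convention for the genesis block). -/
def round : Block n Tx → ℕ
  | genesis => 0
  | mk r _ _ _ _ => r

/-- The issuers of the permits in the proof of a block. -/
def issuers : Block n Tx → Finset (Fin n)
  | genesis => ∅
  | mk _ _ _ I _ => I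

open Classical in
/-- The position from which a block is appended, that is, the set of its parents. -/
def position : Block n Tx → Position n Tx
  | genesis => ∅
  | mk _ _ p _ _ => Finset.univ.image p

/-- The length of a shortest path from the genesis block. -/
def depth : Block n Tx → ℕ
  | genesis => 0
  | mk _ _ p _ _ => (⨅ i, (p i).depth) + 1

/-- Hereditarily, every block other than the genesis block has a nonempty position and a proof made
of `2f + 1` permits of distinct nodes. -/
def Valid (f : ℕ) : Block n Tx → Prop
  | genesis => True
  | mk _ k p I _ => 0 < k ∧ I.card = 2 * f + 1 ∧ ∀ i, (p i).Valid f

/-- `OnPath b c`: the block `b` lies on a path from the genesis block to `c` (possibly `b = c`). -/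
def OnPath (b c : Block n Tx) : Prop :=
  Relation.ReflTransGen (fun x y => x ∈ y.position) b c

/-- In the block graph `G`, a block is committed if it has a child. -/
def Committed (G : Set (Block n Tx)) (b : Block n Tx) : Prop :=
  ∃ c ∈ G, b ∈ c.position

end Block

variable {n : ℕ} {Tx : Type u}

/-- The length of a shortest path from the genesis block to a position. -/
def positionDepth (P : Position n Tx) : ℕ := sInf (Block.depth '' (P : Set (Block n Tx)))

/-- A position is admissible if it is a nonempty set of valid blocks. -/
def PositionValid (f : ℕ) (P : Position n Tx) : Prop :=
  P.Nonempty ∧ ∀ b ∈ P, b.Valid f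

/-- In the block graph `G`, the position `P` respects every block on a path from the genesis block
to `P`, and every uncommitted block whose depth is at most the depth of `P` minus two. -/
def Respects (G : Set (Block n Tx)) (P : Position n Tx) (b : Block n Tx) : Prop :=
  (∃ c ∈ P, b.OnPath c) ∨ (b ∈ G ∧ ¬ b.Committed G ∧ b.depth + 2 ≤ positionDepth P)

/-- A proposal of round `round`: a position and a set of permits of that round, each given by its
issuer and its position. -/
structure Proposal (n : ℕ) (Tx : Type u) where
  round : ℕ
  position : Position n Tx
  permits : Finset (Fin n × Position n Tx)

/-- The block graph that a set of permits refers to. -/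
def referencedGraph (Q : Finset (Fin n × Position n Tx)) : Set (Block n Tx) :=
  {b | ∃ q ∈ Q, ∃ c ∈ q.2, b.OnPath c}

/-- `P` is a minimal position that respects all positions of the permits in `Q`. -/
def IsMinimalPosition (Q : Finset (Fin n × Position n Tx)) (P : Position n Tx) : Prop :=
  Minimal (fun P' : Position n Tx => (P' : Set (Block n Tx)) ⊆ referencedGraph Q ∧
    ∀ q ∈ Q, ∀ b ∈ q.2, Respects (referencedGraph Q) P' b) P

/-- A valid proposal has at least `2f + 1` permits of distinct nodes, and its position is a minimal
one that respects all of them. -/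
def Proposal.Valid (f : ℕ) (p : Proposal n Tx) : Prop :=
  2 * f + 1 ≤ p.permits.card ∧
  (∀ q ∈ p.permits, ∀ q' ∈ p.permits, q.1 = q'.1 → q = q') ∧
  (∀ q ∈ p.permits, PositionValid f q.2) ∧
  IsMinimalPosition p.permits p.position

/-- The result of a round. -/
inductive Result (n : ℕ) (Tx : Type u) : Type u
  | block (b : Block n Tx) : Result n Tx
  | proposal (p : Proposal n Tx) : Result n Tx

namespace Result

def round : Result n Tx → ℕ
  | block b => b.round
  | proposal p => p.round

/-- The position that a node adopts with a result: the new block, or the proposed position. -/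
def position : Result n Tx → Position n Tx
  | block b => {b}
  | proposal p => p.position

def Valid (f : ℕ) : Result n Tx → Prop
  | block b => b ≠ Block.genesis ∧ b.Valid f
  | proposal p => p.Valid f

end Result

/-- Messages. `timeouts r S` is a bundle of timeout messages for round `r`, one of each node
in `S`. -/
inductive Msg (n : ℕ) (Tx : Type u) : Type u
  | permit (issuer : Fin n) (round : ℕ) (position : Position n Tx) : Msg n Tx
  | result (res : Result n Tx) : Msg n Tx
  | timeout (issuer : Fin n) (round : ℕ) : Msg n Tx
  | timeouts (round : ℕ) (issuers : Finset (Fin n)) : Msg n Tx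

/-- The round-robin creator of round `r`, namely `r mod n`. -/
def creator (n : ℕ) [NeZero n] (r : ℕ) : Fin n := Fin.ofNat n r

/-! ## Signatures

Permits and timeout messages are signed by their issuer, blocks and proposals by the creator of
their round. `sent` is the set of all messages that honest nodes have sent so far. A message is
authentic if everything in it that bears the signature of an honest node has been sent by an honest
node before; no other message can be produced. -/

section Authentic

variable [NeZero n] (byz : Finset (Fin n)) (sent : Set (Msg n Tx))

open Classical in
def Block.Authentic : Block n Tx → Prop
  | .genesis => True
  | .mk r k p I txs =>
      (creator n r ∉ byz → Msg.result (.block (.mk r k p I txs)) ∈ sent) ∧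
      (∀ v ∈ I, v ∉ byz → Msg.permit v r (Finset.univ.image p) ∈ sent) ∧
      ∀ i, (p i).Authentic

def PermitAuthentic (v : Fin n) (r : ℕ) (P : Position n Tx) : Prop :=
  (v ∉ byz → Msg.permit v r P ∈ sent) ∧ ∀ b ∈ P, b.Authentic byz sent

def Msg.Authentic : Msg n Tx → Prop
  | .permit v r P => PermitAuthentic byz sent v r P
  | .result (.block b) => b.Authentic byz sent
  | .result (.proposal p) =>
      (creator n p.round ∉ byz → Msg.result (.proposal p) ∈ sent) ∧
      (∀ q ∈ p.permits, PermitAuthentic byz sent q.1 p.round q.2) ∧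
      ∀ b ∈ p.position, b.Authentic byz sent
  | .timeout v r => v ∉ byz → Msg.timeout v r ∈ sent
  | .timeouts r S => ∀ v ∈ S, v ∉ byz → Msg.timeout v r ∈ sent

end Authentic

/-! ## The algorithm run by an honest node -/

/-- The parameters of the algorithm: the bound `f` on the number of byzantine nodes, and the actual
times after which the local timeouts of each node occur. -/
structure Params (n : ℕ) where
  f : ℕ
  creatorTimeout : Fin n → ℝ
  roundTimeout : Fin n → ℝ

/-- The local state of a node. -/
structure NodeState (n : ℕ) (Tx : Type u) where
  round : ℕ
  current : Position n Tx
  /-- whether the node is in its creator phase -/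
  creating : Prop
  /-- all permits (issuer, round, position) received so far -/
  permits : Finset (Fin n × ℕ × Position n Tx)
  /-- all timeout messages (issuer, round) received so far -/
  timeouts : Finset (Fin n × ℕ)
  /-- the block, proposal or `2f + 1` timeout messages that let the node enter its present round -/
  latest : Option (Msg n Tx)
  /-- the results accepted so far -/
  accepted : Set (Result n Tx)
  creatorDeadline : ℝ
  roundDeadline : ℝ

/-- A set of messages together with their addressees. -/
abbrev Out (n : ℕ) (Tx : Type u) := Set (Fin n × Msg n Tx)

section Algorithm

variable [NeZero n] (par : Params n)

namespace NodeState

open Classical in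
/-- The nodes from which a permit for position `P` in round `r` has been received. -/
def permitters (s : NodeState n Tx) (r : ℕ) (P : Position n Tx) : Finset (Fin n) :=
  Finset.univ.filter fun v => (v, r, P) ∈ s.permits

open Classical in
/-- The nodes from which some permit in round `r` has been received. -/
def allPermitters (s : NodeState n Tx) (r : ℕ) : Finset (Fin n) :=
  Finset.univ.filter fun v => ∃ P, (v, r, P) ∈ s.permits

open Classical in
/-- The nodes from which a timeout message for round `r` has been received. -/
def timeoutIssuers (s : NodeState n Tx) (r : ℕ) : Finset (Fin n) :=
  Finset.univ.filter fun v => (v, r) ∈ s.timeouts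

/-- Node `v` starts round `r` at time `t`, permitting the position `P`; it restarts its timers. -/
def enter (v : Fin n) (t : ℝ) (r : ℕ) (P : Position n Tx) (why : Msg n Tx)
    (s : NodeState n Tx) : NodeState n Tx :=
  { s with
    round := r
    current := P
    creating := creator n r = v
    latest := some why
    creatorDeadline := t + par.creatorTimeout v
    roundDeadline := t + par.roundTimeout v }

/-- Node `v` accepts a result at time `t` and starts the round after it. -/
def accept (v : Fin n) (t : ℝ) (res : Result n Tx) (s : NodeState n Tx) : NodeState n Tx :=
  enter par v t (res.round + 1) res.position (.result res)
    { s with accepted := insert res s.accepted }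

/-- The creator can produce a proof, hence a block. -/
def CanCreateBlock (s : NodeState n Tx) : Prop :=
  s.creating ∧ ∃ P, 2 * par.f + 1 ≤ (s.permitters s.round P).card

end NodeState

/-- The permit that node `v` sends on starting round `r`. -/
def permitOut (v : Fin n) (r : ℕ) (P : Position n Tx) : Out n Tx :=
  {(creator n r, .permit v r P)}

/-- The transition to a later round with the help of timeout messages: if there are at least
`2f + 1` of them for the present or a following round, then the maximal such round is left,
and `2f + 1` of these messages are sent to all other nodes. -/
inductive TimeoutAdvance (v : Fin n) (t : ℝ) (s : NodeState n Tx) :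
    NodeState n Tx → Out n Tx → Prop
  | stay (h : ∀ r, s.round ≤ r → (s.timeoutIssuers r).card < 2 * par.f + 1) :
      TimeoutAdvance v t s s ∅
  | advance (r : ℕ) (S : Finset (Fin n))
      (hr : s.round ≤ r) (hS : S ⊆ s.timeoutIssuers r) (hcard : S.card = 2 * par.f + 1)
      (hmax : ∀ r', 2 * par.f + 1 ≤ (s.timeoutIssuers r').card → r' ≤ r) :
      TimeoutAdvance v t s (s.enter par v t (r + 1) s.current (.timeouts r S))
        ({x | x.1 ≠ v ∧ x.2 = .timeouts r S} ∪ permitOut v (r + 1) s.current)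

open Classical in
/-- The reaction of an honest node `v` in local state `s` to the receipt of a message at time `t`:
the new local state and the messages sent. Invalid permits and results are ignored. A timeout
message for an old round is answered by relaying the latest evidence for the present round. -/
inductive Receive (v : Fin n) (t : ℝ) (s : NodeState n Tx) :
    Msg n Tx → NodeState n Tx → Out n Tx → Prop
  | permit (w : Fin n) (r : ℕ) (P : Position n Tx) (h : PositionValid par.f P) :
      Receive v t s (.permit w r P) { s with permits := insert (w, r, P) s.permits } ∅
  | permitInvalid (w : Fin n) (r : ℕ) (P : Position n Tx) (h : ¬ PositionValid par.f P) :
      Receive v t s (.permit w r P) s ∅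
  | result (res : Result n Tx) (hv : res.Valid par.f) (hr : s.round ≤ res.round) :
      Receive v t s (.result res) (s.accept par v t res)
        (permitOut v (res.round + 1) res.position)
  | resultIgnored (res : Result n Tx) (h : ¬ (res.Valid par.f ∧ s.round ≤ res.round)) :
      Receive v t s (.result res) s ∅
  | timeout (w : Fin n) (r : ℕ) (s' : NodeState n Tx) (out : Out n Tx)
      (h : TimeoutAdvance par v t { s with timeouts := insert (w, r) s.timeouts } s' out) :
      Receive v t s (.timeout w r) s'
        (out ∪ {x | r < s.round ∧ x.1 = w ∧ s.latest = some x.2})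
  | timeouts (r : ℕ) (S : Finset (Fin n)) (s' : NodeState n Tx) (out : Out n Tx)
      (h : TimeoutAdvance par v t
        { s with timeouts := s.timeouts ∪ S.image (fun w => (w, r)) } s' out) :
      Receive v t s (.timeouts r S) s' out

/-- The actions that an honest node `v` takes at time `t` without receiving a message. -/
inductive Act (v : Fin n) (t : ℝ) (s : NodeState n Tx) : NodeState n Tx → Out n Tx → Prop
  /-- In its creator phase, the node has `2f + 1` permits for one position. It creates a block with
  some set of transactions, sends it to all nodes, and accepts it. -/
  | createBlock (b : Block n Tx) (hc : s.creating) (hb : b ≠ .genesis) (hr : b.round = s.round)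
      (hI : b.issuers ⊆ s.permitters s.round b.position)
      (hcard : b.issuers.card = 2 * par.f + 1) :
      Act v t s (s.accept par v t (.block b))
        ({x | x.2 = .result (.block b)} ∪ permitOut v (b.round + 1) {b})
  /-- At its creator timeout, the node has permits of `2f + 1` nodes. It sends a proposal with all
  permits (one for each issuer) to all nodes, and accepts it. -/
  | propose (p : Proposal n Tx) (hc : s.creating) (ht : s.creatorDeadline ≤ t)
      (hb : ¬ s.CanCreateBlock par) (henough : 2 * par.f + 1 ≤ (s.allPermitters s.round).card)
      (hr : p.round = s.round)
      (hsub : ∀ q ∈ p.permits, (q.1, s.round, q.2) ∈ s.permits)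
      (huniq : ∀ w ∈ s.allPermitters s.round, ∃! P, (w, P) ∈ p.permits)
      (hmin : IsMinimalPosition p.permits p.position) :
      Act v t s (s.accept par v t (.proposal p))
        ({x | x.2 = .result (.proposal p)} ∪ permitOut v (p.round + 1) p.position)
  /-- At its creator timeout, the node has too few permits and ends its creator phase. -/
  | giveUp (hc : s.creating) (ht : s.creatorDeadline ≤ t)
      (hb : ¬ s.CanCreateBlock par) (hfew : (s.allPermitters s.round).card < 2 * par.f + 1) :
      Act v t s { s with creating := False } ∅
  /-- Whenever the round timeout occurs, the node sends a timeout message to all nodes; the timer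
  is then restarted. -/
  | roundTimeout (ht : s.roundDeadline ≤ t) :
      Act v t s { s with roundDeadline := t + par.roundTimeout v }
        {x | x.2 = .timeout v s.round}

end Algorithm

/-! ## Executions -/

/-- A message on its way between two honest nodes. -/
structure Envelope (n : ℕ) (Tx : Type u) where
  src : Fin n
  dst : Fin n
  msg : Msg n Tx
  sentAt : ℝ

/-- The global state of the system. The local states of byzantine nodes are irrelevant. -/
structure State (n : ℕ) (Tx : Type u) where
  now : ℝ
  node : Fin n → NodeState n Tx
  inTransit : Set (Envelope n Tx)
  /-- all messages that honest nodes have sent so far, to whatever addressee -/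
  sent : Set (Msg n Tx)

section Executions

variable [NeZero n] (par : Params n) (byz : Finset (Fin n))

/-- The messages `out` of node `v`, put on the network at time `t`. Messages to byzantine nodes need
not be tracked, as byzantine nodes may use every message that has been sent. -/
def envelopes (v : Fin n) (t : ℝ) (out : Out n Tx) : Set (Envelope n Tx) :=
  {e | e.src = v ∧ e.sentAt = t ∧ e.dst ∉ byz ∧ (e.dst, e.msg) ∈ out}

open Classical in
/-- The global state after node `v` has changed its local state to `s` and has sent `out`. -/
def State.update (S : State n Tx) (v : Fin n) (s : NodeState n Tx) (out : Out n Tx) :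
    State n Tx where
  now := S.now
  node := Function.update S.node v s
  inTransit := S.inTransit ∪ envelopes byz v S.now out
  sent := S.sent ∪ {m | ∃ w, (w, m) ∈ out}

/-- At time `0` all honest nodes start round `0` with a permit for the genesis block. -/
def initialState : State n Tx where
  now := 0
  node v :=
    { round := 0
      current := {Block.genesis}
      creating := creator n 0 = v
      permits := ∅
      timeouts := ∅
      latest := none
      accepted := ∅
      creatorDeadline := par.creatorTimeout v
      roundDeadline := par.roundTimeout v }
  inTransit := ⋃ v ∈ {v | v ∉ byz}, envelopes byz v 0 (permitOut v 0 {Block.genesis})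
  sent := {m | ∃ v, v ∉ byz ∧ m = .permit v 0 {Block.genesis}}

/-- One step of the system. Computation takes no time: time does not pass while an honest creator
can create a block, and it does not pass beyond the expiry of a timer of an honest node. Messages
may be delivered in any order. Byzantine nodes may send any authentic message to anyone at any
time. -/
inductive Step (S : State n Tx) : State n Tx → Prop
  | tick (t : ℝ) (ht : S.now ≤ t)
      (hblock : ∀ v, v ∉ byz → ¬ (S.node v).CanCreateBlock par)
      (hcreator : ∀ v, v ∉ byz → (S.node v).creating → t ≤ (S.node v).creatorDeadline)
      (hround : ∀ v, v ∉ byz → t ≤ (S.node v).roundDeadline) :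
      Step S { S with now := t }
  | deliver (e : Envelope n Tx) (he : e ∈ S.inTransit) (s : NodeState n Tx) (out : Out n Tx)
      (h : Receive par e.dst S.now (S.node e.dst) e.msg s out) :
      Step S (State.update byz { S with inTransit := S.inTransit \ {e} } e.dst s out)
  | byzantine (w v : Fin n) (hw : w ∈ byz) (hv : v ∉ byz) (m : Msg n Tx)
      (hm : m.Authentic byz S.sent) (s : NodeState n Tx) (out : Out n Tx)
      (h : Receive par v S.now (S.node v) m s out) :
      Step S (State.update byz S v s out)
  | act (v : Fin n) (hv : v ∉ byz) (s : NodeState n Tx) (out : Out n Tx)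
      (h : Act par v S.now (S.node v) s out) :
      Step S (State.update byz S v s out)

/-- An execution of PermitBFT with the set `byz` of byzantine nodes: an infinite sequence of steps
in the course of which time grows beyond all bounds. -/
structure Execution (par : Params n) (byz : Finset (Fin n)) (Tx : Type u) where
  state : ℕ → State n Tx
  start : state 0 = initialState par byz
  step : ∀ k, Step par byz (state k) (state (k + 1))
  diverges : Tendsto (fun k => (state k).now) atTop atTop

variable {par byz}

/-- `[a, b]` is a period of synchrony with maximum message delay `Δ`: every message between honest
nodes is delivered within `Δ` after it was sent or, if it was sent before the period, within `Δ`
after the beginning of the period (as far as this time is not after the end of the period). -/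
def Execution.Synchronous (E : Execution par byz Tx) (Δ a b : ℝ) : Prop :=
  ∀ k, ∀ e ∈ (E.state k).inTransit,
    max e.sentAt a + Δ ≤ b → (E.state k).now ≤ max e.sentAt a + Δ

/-- The honest creator of its round creates the block `b` in the `k`-th step. -/
def Execution.CreatesBlock (E : Execution par byz Tx) (k : ℕ) (b : Block n Tx) : Prop :=
  creator n b.round ∉ byz ∧ b.Valid par.f ∧
  Msg.result (.block b) ∉ (E.state k).sent ∧ Msg.result (.block b) ∈ (E.state (k + 1)).sent

/-- Confirmation of the block `b` by a position: `b` is in the position, or the position has a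
member that was appended to a position confirming `b`, or the position was adopted with a proposal
from `X` one of whose permits (all of which it respects) is for a position confirming `b`. -/
inductive Confirms (X : Set (Proposal n Tx)) (b : Block n Tx) : Position n Tx → Prop
  | mem {P : Position n Tx} (h : b ∈ P) : Confirms X b P
  | child {P : Position n Tx} (c : Block n Tx) (hc : c ∈ P) (h : Confirms X b c.position) :
      Confirms X b P
  | proposal (p : Proposal n Tx) (hp : p ∈ X) (v : Fin n) (R : Position n Tx)
      (hR : (v, R) ∈ p.permits) (h : Confirms X b R) : Confirms X b p.position

/-- The proposals that honest nodes have accepted within the first `k` steps. -/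
def Execution.acceptedProposals (E : Execution par byz Tx) (k : ℕ) : Set (Proposal n Tx) :=
  {p | ∃ v, v ∉ byz ∧ Result.proposal p ∈ ((E.state k).node v).accepted}

/-- In the `k`-th step, node `v`, which has not yet started any round after that of `b`,
accepts `b`: either `b` itself, or implicitly, by accepting a block or proposal of a later round
whose position confirms `b`. -/
def Execution.AcceptsBlock (E : Execution par byz Tx) (k : ℕ) (v : Fin n) (b : Block n Tx) :
    Prop :=
  ((E.state k).node v).round ≤ b.round ∧
  ∃ res, res ∉ ((E.state k).node v).accepted ∧ res ∈ ((E.state (k + 1)).node v).accepted ∧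
    (res = .block b ∨
      (b.round < res.round ∧ Confirms (E.acceptedProposals (k + 1)) b res.position))

end Executions

end

end PermitBFT

/-!
The argument rests on three facts about the protocol, which hold in every execution.

* A result, and a bundle of `2f + 1` timeout messages, contains a signature of an honest node that
  has been in its round. So the honest nodes never skip a round together (`round_eq_of_first`), and
  a round cannot be left by timeout before an honest round timeout has expired in it
  (`LeavesByTimeout.lt_now`).
* An honest creator sends its only result of a round to all nodes, and a node that leaves a round by
  timeout forwards the timeout messages. So a round with an honest creator is left by all honest
  nodes within `Δ` of each other during synchrony (`spread`).
* Time cannot pass an expired timer, nor while an honest creator can create a block. So a node that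
  is stuck with an expired timer, or a creator with enough permits, would bound the time of the
  execution, which diverges.

During synchrony honest nodes lag behind by at most `n` rounds, since some of any `n` successive
rounds have honest creators. Laggards catch up because their timeout messages are answered with
evidence for the highest round (`catch_up`), and if all stay in one round, then they all send
timeout messages for it. Hence the highest round grows in bounded time (`exists_next_round`).

As `3f < n`, there are three successive rounds with honest creators among any `n + 2`
(`exists_honest_creators`). The first one makes all honest nodes start the second one, say from time
`t` on, within `Δ`. By `t + 2Δ` the second creator has the permits of all honest nodes, so that it
creates a block or a proposal before `t + 4Δ`; all honest nodes receive it before their round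
timeouts. Whoever starts the third round therefore does so with the same position, and the third
creator creates a block `B` before its creator timeout (`exists_end_of_common_round`). All honest
nodes receive `B` within `Δ`. A node that has left the round of `B` by then has done so by accepting
a later result, because no round timeout has expired; the permits in it are made by nodes whose
positions confirm `B`, by induction on the steps (`confirms_of_permit`).
-/

namespace PermitBFT

variable {n : ℕ} {Tx : Type u}

/-! ### Counting honest nodes -/

theorem exists_honest_of_card {byz S : Finset (Fin n)} (h : byz.card < S.card) :
    ∃ v ∈ S, v ∉ byz :=
  Finset.exists_mem_notMem_of_card_lt_card h

theorem card_honest {f : ℕ} {byz : Finset (Fin n)} (hbyz : byz.card ≤ f) (hf : 3 * f < n) :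
    2 * f + 1 ≤ (Finset.univ.filter (· ∉ byz)).card := by
  rw [Finset.filter_notMem_eq_sdiff, Finset.card_univ_sdiff, Fintype.card_fin]
  omega

/-! ### Valid blocks, positions and results -/

theorem Block.Valid.of_mem_position {f : ℕ} {b c : Block n Tx} (hc : c.Valid f)
    (h : b ∈ c.position) : b.Valid f := by
  cases c with
  | genesis => simp [Block.position] at h
  | mk r k p I txs =>
    simp only [Block.position, Finset.mem_image, Finset.mem_univ, true_and] at h
    obtain ⟨i, rfl⟩ := h
    simp only [Block.Valid] at hc
    exact hc.2.2 i

theorem Block.Valid.of_onPath {f : ℕ} {b c : Block n Tx} (hc : c.Valid f)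
    (h : b.OnPath c) : b.Valid f := by
  unfold Block.OnPath at h
  induction h with
  | refl => exact hc
  | tail _ hyz ih => exact ih (hc.of_mem_position hyz)

theorem Block.valid_of_position {f : ℕ} {b : Block n Tx} (hb : b ≠ .genesis)
    (hp : PositionValid f b.position) (hI : b.issuers.card = 2 * f + 1) : b.Valid f := by
  cases b with
  | genesis => exact absurd rfl hb
  | mk r k p I txs =>
    simp only [Block.Valid]
    obtain ⟨⟨c, hc⟩, hv⟩ := hp
    simp only [Block.position, Finset.mem_image, Finset.mem_univ, true_and] at hc hv
    obtain ⟨i, -⟩ := hc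
    exact ⟨i.pos, hI, fun j => hv _ ⟨j, rfl⟩⟩

theorem positionValid_genesis (f : ℕ) : PositionValid f ({Block.genesis} : Position n Tx) :=
  ⟨Finset.singleton_nonempty _, by simp [Block.Valid]⟩

/-- A minimal position respecting admissible permits is itself admissible: its blocks lie on paths
to permitted blocks, and the empty position respects nothing because its depth is `0`. -/
theorem Proposal.Valid.positionValid {f : ℕ} {p : Proposal n Tx} (h : p.Valid f) :
    PositionValid f p.position := by
  obtain ⟨hcard, -, hv, hmin⟩ := h
  obtain ⟨hsub, hres⟩ := hmin.prop
  refine ⟨?_, fun b hb => ?_⟩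
  · obtain ⟨q, hq⟩ : p.permits.Nonempty := Finset.card_pos.1 (by omega)
    obtain ⟨b, hb⟩ := (hv q hq).1
    rcases hres q hq b hb with ⟨c, hc, -⟩ | ⟨-, -, hd⟩
    · exact ⟨c, hc⟩
    · rw [Finset.nonempty_iff_ne_empty]
      intro he
      simp [he, positionDepth] at hd
  · obtain ⟨q, hq, c, hc, hbc⟩ := hsub (Finset.mem_coe.2 hb)
    exact ((hv q hq).2 c hc).of_onPath hbc

theorem Result.Valid.positionValid {f : ℕ} {res : Result n Tx} (h : res.Valid f) :
    PositionValid f res.position := by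
  cases res with
  | block b => exact ⟨Finset.singleton_nonempty _, by simpa [Result.position] using h.2⟩
  | proposal p => exact Proposal.Valid.positionValid h

/-- The permits, as pairs of issuer and position, that a result is made of. -/
def Result.support : Result n Tx → Set (Fin n × Position n Tx)
  | .block b => {q | q.1 ∈ b.issuers ∧ q.2 = b.position}
  | .proposal p => {q | q ∈ p.permits}

theorem Result.Valid.exists_honest {f : ℕ} {byz : Finset (Fin n)} (hbyz : byz.card ≤ f)
    {res : Result n Tx} (h : res.Valid f) : ∃ q ∈ res.support, q.1 ∉ byz := by
  classical
  cases res with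
  | block b =>
    obtain ⟨hb, hv⟩ := h
    have hc : b.issuers.card = 2 * f + 1 := by
      cases b with
      | genesis => exact absurd rfl hb
      | mk r k p I txs => simp only [Block.Valid] at hv; exact hv.2.1
    obtain ⟨v, hv, hvb⟩ := exists_honest_of_card (byz := byz) (S := b.issuers) (by omega)
    exact ⟨(v, b.position), ⟨hv, rfl⟩, hvb⟩
  | proposal p =>
    obtain ⟨hcard, huniq, -, -⟩ := h
    have hc : (p.permits.image Prod.fst).card = p.permits.card :=
      Finset.card_image_of_injOn fun q hq q' hq' hqq => huniq q hq q' hq' hqq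
    obtain ⟨v, hv, hvb⟩ :=
      exists_honest_of_card (byz := byz) (S := p.permits.image Prod.fst) (by omega)
    obtain ⟨q, hq, rfl⟩ := Finset.mem_image.1 hv
    exact ⟨q, hq, hvb⟩

theorem Confirms.mono {X Y : Set (Proposal n Tx)} (hXY : X ⊆ Y) {b : Block n Tx}
    {P : Position n Tx} (h : Confirms X b P) : Confirms Y b P := by
  induction h with
  | mem h => exact .mem h
  | child c hc _ ih => exact .child c hc ih
  | proposal p hp v R hR _ ih => exact .proposal p (hXY hp) v R hR ih

/-! ### Credible messages -/

variable [NeZero n]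

/-- The consequences of authenticity that matter for liveness: signatures of honest nodes on the
message itself and on the permits or timeout messages it directly contains are genuine. Unlike
authenticity, this does not look into the ancestors of blocks, and it says nothing about invalid
results, which honest nodes ignore. -/
def Credible (f : ℕ) (byz : Finset (Fin n)) (sent : Set (Msg n Tx)) : Msg n Tx → Prop
  | .permit v r P => v ∉ byz → .permit v r P ∈ sent
  | .result res => res.Valid f → (creator n res.round ∉ byz → .result res ∈ sent) ∧
      ∀ q ∈ res.support, q.1 ∉ byz → .permit q.1 res.round q.2 ∈ sent
  | .timeout v r => v ∉ byz → .timeout v r ∈ sent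
  | .timeouts r S => ∀ v ∈ S, v ∉ byz → .timeout v r ∈ sent

theorem Credible.mono {f : ℕ} {byz : Finset (Fin n)} {sent sent' : Set (Msg n Tx)}
    (hs : sent ⊆ sent') {m : Msg n Tx} (h : Credible f byz sent m) :
    Credible f byz sent' m := by
  cases m with
  | permit v r P => exact fun hv => hs (h hv)
  | result res =>
    exact fun hv => ⟨fun hc => hs ((h hv).1 hc), fun q hq hqb => hs ((h hv).2 q hq hqb)⟩
  | timeout v r => exact fun hv => hs (h hv)
  | timeouts r S => exact fun v hv hvb => hs (h v hv hvb)

theorem Msg.Authentic.credible (f : ℕ) {byz : Finset (Fin n)} {sent : Set (Msg n Tx)}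
    {m : Msg n Tx} (h : m.Authentic byz sent) : Credible f byz sent m := by
  cases m with
  | permit v r P => exact h.1
  | result res =>
    intro hv
    cases res with
    | block b =>
      cases b with
      | genesis => exact absurd rfl hv.1
      | mk r k p I txs =>
        simp only [Msg.Authentic, Block.Authentic] at h
        refine ⟨h.1, ?_⟩
        rintro ⟨v, P⟩ ⟨hvI, rfl⟩ hvb
        exact h.2.1 v hvI hvb
    | proposal p => exact ⟨h.1, fun q hq hqb => (h.2.1 q hq).1 hqb⟩
  | timeout v r => exact h
  | timeouts r S => exact h

/-- `Evidence f m r`: the message `m` justifies entering round `r`. -/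
def Evidence (f : ℕ) : Msg n Tx → ℕ → Prop
  | .result res, r => res.Valid f ∧ r = res.round + 1
  | .timeouts r' S, r => r = r' + 1 ∧ S.card = 2 * f + 1
  | _, _ => False

/-! ### Local steps of honest nodes -/

variable {par : Params n} {byz : Finset (Fin n)}

/-- A normal form for what an honest node does in one step, with the provenance of the messages it
reacts to. `sent` is the set of messages sent by honest nodes before the step. -/
inductive LocalStep (par : Params n) (byz : Finset (Fin n)) (sent : Set (Msg n Tx)) (v : Fin n)
    (t : ℝ) (s : NodeState n Tx) : NodeState n Tx → Out n Tx → Prop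
  | learnPermits (Q : Finset (Fin n × ℕ × Position n Tx)) (hsub : s.permits ⊆ Q)
      (hQ : ∀ q ∈ Q, q ∈ s.permits ∨
        (PositionValid par.f q.2.2 ∧ (q.1 ∉ byz → .permit q.1 q.2.1 q.2.2 ∈ sent))) :
      LocalStep par byz sent v t s { s with permits := Q } ∅
  | learnTimeouts (T : Finset (Fin n × ℕ)) (out : Out n Tx) (hsub : s.timeouts ⊆ T)
      (hT : ∀ q ∈ T, q ∈ s.timeouts ∨ (q.1 ∉ byz → .timeout q.1 q.2 ∈ sent))
      (hfew : ∀ r, s.round ≤ r →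
        (NodeState.timeoutIssuers { s with timeouts := T } r).card < 2 * par.f + 1)
      (hout : ∀ x ∈ out, s.latest = some x.2) :
      LocalStep par byz sent v t s { s with timeouts := T } out
  | advance (T : Finset (Fin n × ℕ)) (r : ℕ) (S : Finset (Fin n)) (out : Out n Tx)
      (hsub : s.timeouts ⊆ T)
      (hT : ∀ q ∈ T, q ∈ s.timeouts ∨ (q.1 ∉ byz → .timeout q.1 q.2 ∈ sent))
      (hr : s.round ≤ r) (hS : ∀ w ∈ S, (w, r) ∈ T) (hcard : S.card = 2 * par.f + 1)
      (hmax : ∀ r', 2 * par.f + 1 ≤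
        (NodeState.timeoutIssuers { s with timeouts := T } r').card → r' ≤ r)
      (hsubout : {x | x.1 ≠ v ∧ x.2 = .timeouts r S} ∪ permitOut v (r + 1) s.current ⊆ out)
      (hout : ∀ x ∈ out, x.2 = .timeouts r S ∨ x.2 = .permit v (r + 1) s.current ∨
        s.latest = some x.2) :
      LocalStep par byz sent v t s
        (NodeState.enter par v t (r + 1) s.current (.timeouts r S) { s with timeouts := T }) out
  | receive (res : Result n Tx) (hv : res.Valid par.f) (hr : s.round ≤ res.round)
      (hcred : Credible par.f byz sent (.result res)) :
      LocalStep par byz sent v t s (s.accept par v t res) (permitOut v (res.round + 1) res.position)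
  | create (res : Result n Tx) (hc : s.creating) (hv : res.Valid par.f) (hr : res.round = s.round)
      (hsup : ∀ q ∈ res.support, (q.1, s.round, q.2) ∈ s.permits)
      (hprop : ∀ p, res = .proposal p → s.creatorDeadline ≤ t) :
      LocalStep par byz sent v t s (s.accept par v t res)
        ({x | x.2 = .result res} ∪ permitOut v (res.round + 1) res.position)
  | giveUp (hc : s.creating) (ht : s.creatorDeadline ≤ t) (hb : ¬ s.CanCreateBlock par)
      (hfew : (s.allPermitters s.round).card < 2 * par.f + 1) :
      LocalStep par byz sent v t s { s with creating := False } ∅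
  | roundTimeout (ht : s.roundDeadline ≤ t) :
      LocalStep par byz sent v t s { s with roundDeadline := t + par.roundTimeout v }
        {x | x.2 = .timeout v s.round}

theorem TimeoutAdvance.localStep {sent : Set (Msg n Tx)} {v : Fin n} {t : ℝ}
    {s s' : NodeState n Tx} {out : Out n Tx} {T : Finset (Fin n × ℕ)} (hsub : s.timeouts ⊆ T)
    (hT : ∀ q ∈ T, q ∈ s.timeouts ∨ (q.1 ∉ byz → .timeout q.1 q.2 ∈ sent))
    (h : TimeoutAdvance par v t { s with timeouts := T } s' out) (extra : Out n Tx)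
    (hextra : ∀ x ∈ extra, s.latest = some x.2) :
    LocalStep par byz sent v t s s' (out ∪ extra) := by
  cases h with
  | stay h => exact .learnTimeouts T _ hsub hT h (by simpa using hextra)
  | advance r S hr hS hcard hmax =>
    refine .advance T r S _ hsub hT hr (fun w hw => ?_) hcard hmax Set.subset_union_left ?_
    · have := hS hw
      simpa [NodeState.timeoutIssuers] using this
    · rintro x ((hx | hx) | hx)
      · exact .inl hx.2
      · rw [permitOut, Set.mem_singleton_iff] at hx
        subst hx
        exact .inr (.inl rfl)
      · exact .inr (.inr (hextra x hx))

theorem Receive.localStep {sent : Set (Msg n Tx)} {v : Fin n} {t : ℝ} {s s' : NodeState n Tx}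
    {m : Msg n Tx} {out : Out n Tx} (h : Receive par v t s m s' out)
    (hm : Credible par.f byz sent m) : LocalStep par byz sent v t s s' out := by
  classical
  cases h with
  | permit w r P hP =>
    refine .learnPermits _ (Finset.subset_insert _ _) fun q hq => ?_
    rcases Finset.mem_insert.1 hq with rfl | hq
    · exact .inr ⟨hP, hm⟩
    · exact .inl hq
  | permitInvalid w r P hP => exact .learnPermits s.permits (fun _ h => h) fun q hq => .inl hq
  | result res hv hr => exact .receive res hv hr hm
  | resultIgnored res hP => exact .learnPermits s.permits (fun _ h => h) fun q hq => .inl hq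
  | timeout w r s' out h =>
    refine h.localStep (Finset.subset_insert _ _) (fun q hq => ?_) _ fun x hx => hx.2.2
    rcases Finset.mem_insert.1 hq with rfl | hq
    · exact .inr hm
    · exact .inl hq
  | timeouts r S s' out h =>
    have := h.localStep (byz := byz) (sent := sent) Finset.subset_union_left (fun q hq => ?_) ∅
      (by simp)
    · simpa using this
    · rcases Finset.mem_union.1 hq with hq | hq
      · exact .inl hq
      · obtain ⟨w, hw, rfl⟩ := Finset.mem_image.1 hq
        exact .inr (hm w hw)

theorem Act.localStep {sent : Set (Msg n Tx)} {v : Fin n} {t : ℝ} {s s' : NodeState n Tx}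
    {out : Out n Tx} (h : Act par v t s s' out)
    (hs : ∀ w r P, (w, r, P) ∈ s.permits → PositionValid par.f P) :
    LocalStep par byz sent v t s s' out := by
  classical
  cases h with
  | createBlock b hc hb hr hI hcard =>
    have hmem : ∀ w ∈ b.issuers, (w, s.round, b.position) ∈ s.permits := fun w hw => by
      simpa [NodeState.permitters] using hI hw
    obtain ⟨w, hw⟩ : b.issuers.Nonempty := Finset.card_pos.1 (by omega)
    refine .create (.block b) hc ⟨hb, ?_⟩ hr ?_ (by simp)
    · exact Block.valid_of_position hb (hs _ _ _ (hmem w hw)) hcard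
    · rintro ⟨w, P⟩ ⟨hw, rfl⟩
      exact hmem w hw
  | propose p hc ht hb henough hr hsub huniq hmin =>
    have hall : ∀ q ∈ p.permits, q.1 ∈ s.allPermitters s.round := fun q hq => by
      simpa [NodeState.allPermitters] using ⟨_, hsub q hq⟩
    refine .create (.proposal p) hc ⟨?_, ?_, ?_, hmin⟩ hr hsub (fun _ _ => ht)
    · refine henough.trans ((Finset.card_le_card (t := p.permits.image Prod.fst) ?_).trans
        Finset.card_image_le)
      intro w hw
      obtain ⟨P, hP, -⟩ := huniq w hw
      exact Finset.mem_image.2 ⟨_, hP, rfl⟩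
    · rintro ⟨w, P⟩ hq ⟨w', P'⟩ hq' h
      obtain rfl : w = w' := h
      rw [(huniq w (hall _ hq)).unique hq hq']
    · exact fun q hq => hs _ _ _ (hsub q hq)
  | giveUp hc ht hb hfew => exact .giveUp hc ht hb hfew
  | roundTimeout ht => exact .roundTimeout ht

namespace LocalStep

variable {sent : Set (Msg n Tx)} {v : Fin n} {t : ℝ} {s s' : NodeState n Tx} {out : Out n Tx}

theorem round_le (h : LocalStep par byz sent v t s s' out) : s.round ≤ s'.round := by
  cases h <;> simp only [NodeState.accept, NodeState.enter] <;> omega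

theorem permits_subset (h : LocalStep par byz sent v t s s' out) : s.permits ⊆ s'.permits := by
  cases h <;> simp only [NodeState.accept, NodeState.enter] <;>
    first | assumption | exact fun _ h => h

theorem timeouts_subset (h : LocalStep par byz sent v t s s' out) :
    s.timeouts ⊆ s'.timeouts := by
  cases h <;> simp only [NodeState.accept, NodeState.enter] <;>
    first | assumption | exact fun _ h => h

theorem accepted_subset (h : LocalStep par byz sent v t s s' out) :
    s.accepted ⊆ s'.accepted := by
  cases h <;> simp only [NodeState.accept, NodeState.enter] <;>
    first | exact fun _ h => h | exact Set.subset_insert _ _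

/-- The permits, timeout messages and results that an honest node signs; everything else it
sends is a bundle of timeout messages or evidence it has received before. -/
theorem mem_out (h : LocalStep par byz sent v t s s' out) {x : Fin n × Msg n Tx} (hx : x ∈ out) :
    s.latest = some x.2 ∨
    (s.round < s'.round ∧ x.2 = .permit v s'.round s'.current) ∨
    (s.roundDeadline ≤ t ∧ x.2 = .timeout v s.round) ∨
    (∃ r S, x.2 = .timeouts r S ∧ ∀ w ∈ S, (w, r) ∈ s'.timeouts) ∨
    (∃ res, x.2 = .result res ∧ s.creating ∧ res.Valid par.f ∧ res.round = s.round ∧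
      s'.round = s.round + 1 ∧
      (∀ q ∈ res.support, (q.1, s.round, q.2) ∈ s.permits) ∧
      (∀ p, res = .proposal p → s.creatorDeadline ≤ t) ∧
      ∀ w, (w, .result res) ∈ out) := by
  cases h with
  | learnPermits => exact absurd hx (Set.notMem_empty _)
  | giveUp => exact absurd hx (Set.notMem_empty _)
  | learnTimeouts T out hsub hT hfew hout => exact .inl (hout x hx)
  | advance T r S out hsub hT hr hS hcard hmax hsubout hout =>
    rcases hout x hx with h | h | h
    · exact .inr (.inr (.inr (.inl ⟨r, S, h, hS⟩)))
    · exact .inr (.inl ⟨Nat.lt_succ_of_le hr, h⟩)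
    · exact .inl h
  | receive res hv hr hcred =>
    rw [permitOut, Set.mem_singleton_iff] at hx
    subst hx
    exact .inr (.inl ⟨Nat.lt_succ_of_le hr, rfl⟩)
  | create res hc hv hr hsup hprop =>
    rcases hx with hx | hx
    · exact .inr (.inr (.inr (.inr ⟨res, hx, hc, hv, hr, congrArg (· + 1) hr, hsup, hprop,
        fun w => .inl rfl⟩)))
    · rw [permitOut, Set.mem_singleton_iff] at hx
      subst hx
      exact .inr (.inl ⟨Nat.lt_succ_of_le hr.ge, rfl⟩)
  | roundTimeout ht => exact .inr (.inr (.inl ⟨ht, hx⟩))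

end LocalStep

/-! ### Reactions to particular messages -/

section Receive

variable {v : Fin n} {t : ℝ} {s s' : NodeState n Tx} {out : Out n Tx}

theorem TimeoutAdvance.timeouts_eq (h : TimeoutAdvance par v t s s' out) :
    s'.timeouts = s.timeouts := by
  cases h <;> rfl

theorem TimeoutAdvance.lt_round (h : TimeoutAdvance par v t s s' out) {r : ℕ}
    (hr : 2 * par.f + 1 ≤ (s.timeoutIssuers r).card) : r < s'.round := by
  cases h with
  | stay h =>
    by_contra hlt
    exact absurd (h r (not_lt.1 hlt)) (not_lt.2 hr)
  | advance r' S hr' hS hcard hmax => exact Nat.lt_succ_of_le (hmax r hr)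

theorem Receive.lt_round_of_result {res : Result n Tx}
    (h : Receive par v t s (.result res) s' out) (hv : res.Valid par.f) :
    res.round < s'.round := by
  cases h with
  | result _ _ hr => exact Nat.lt_succ_self _
  | resultIgnored _ h =>
    by_contra hlt
    exact h ⟨hv, not_lt.1 hlt⟩

theorem Receive.lt_round_of_timeouts {r : ℕ} {S : Finset (Fin n)}
    (h : Receive par v t s (.timeouts r S) s' out) (hS : S.card = 2 * par.f + 1) :
    r < s'.round := by
  classical
  cases h with
  | timeouts _ _ _ _ h =>
    refine h.lt_round (hS.symm.le.trans (Finset.card_le_card fun w hw => ?_))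
    simp [NodeState.timeoutIssuers, hw]

theorem Receive.le_round_of_evidence {m : Msg n Tx} {r : ℕ} (h : Receive par v t s m s' out)
    (hm : Evidence par.f m r) : r ≤ s'.round := by
  cases m with
  | permit => exact hm.elim
  | timeout => exact hm.elim
  | result res =>
    obtain ⟨hv, rfl⟩ := hm
    exact h.lt_round_of_result hv
  | timeouts r' S =>
    obtain ⟨rfl, hS⟩ := hm
    exact h.lt_round_of_timeouts hS

theorem Receive.mem_permits {w : Fin n} {r : ℕ} {P : Position n Tx}
    (h : Receive par v t s (.permit w r P) s' out) (hP : PositionValid par.f P) :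
    (w, r, P) ∈ s'.permits := by
  classical
  cases h with
  | permit => exact Finset.mem_insert_self _ _
  | permitInvalid _ _ _ h => exact absurd hP h

theorem Receive.mem_timeouts {w : Fin n} {r : ℕ} (h : Receive par v t s (.timeout w r) s' out) :
    (w, r) ∈ s'.timeouts := by
  classical
  cases h with
  | timeout _ _ _ _ h =>
    rw [h.timeouts_eq]
    exact Finset.mem_insert_self _ _

theorem Receive.mem_out_of_timeout {w : Fin n} {r : ℕ} {m : Msg n Tx}
    (h : Receive par v t s (.timeout w r) s' out) (hr : r < s.round) (hm : s.latest = some m) :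
    (w, m) ∈ out := by
  cases h with
  | timeout _ _ _ _ h => exact .inr ⟨hr, rfl, hm⟩

end Receive

/-! ### Invariants -/

/-- The invariant of the local state `s` of the honest node `v` at time `t`, when honest nodes have
sent the messages in `sent`. -/
structure NodeInv (par : Params n) (byz : Finset (Fin n)) (sent : Set (Msg n Tx)) (v : Fin n)
    (t : ℝ) (s : NodeState n Tx) : Prop where
  permits_valid : ∀ w r P, (w, r, P) ∈ s.permits → PositionValid par.f P
  permits_sent : ∀ w r P, (w, r, P) ∈ s.permits → w ∉ byz → .permit w r P ∈ sent
  timeouts_sent : ∀ w r, (w, r) ∈ s.timeouts → w ∉ byz → .timeout w r ∈ sent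
  few_timeouts : ∀ r, s.round ≤ r → (s.timeoutIssuers r).card < 2 * par.f + 1
  round_eq_zero : s.latest = none → s.round = 0
  evidence : ∀ m, s.latest = some m → Credible par.f byz sent m ∧ Evidence par.f m s.round
  current_valid : PositionValid par.f s.current
  creator_eq : s.creating → creator n s.round = v
  accepted_lt : ∀ res ∈ s.accepted, res.round < s.round
  creatorDeadline_le : s.creatorDeadline ≤ t + par.creatorTimeout v
  roundDeadline_le : s.roundDeadline ≤ t + par.roundTimeout v
  le_roundDeadline : t ≤ s.roundDeadline
  le_creatorDeadline : s.creating → t ≤ s.creatorDeadline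

theorem NodeInv.mono {sent sent' : Set (Msg n Tx)} {v : Fin n} {t t' : ℝ} {s : NodeState n Tx}
    (h : NodeInv par byz sent v t s) (hs : sent ⊆ sent') (ht : t ≤ t')
    (hr : t' ≤ s.roundDeadline) (hc : s.creating → t' ≤ s.creatorDeadline) :
    NodeInv par byz sent' v t' s where
  permits_valid := h.permits_valid
  permits_sent w r P hP hw := hs (h.permits_sent w r P hP hw)
  timeouts_sent w r hr hw := hs (h.timeouts_sent w r hr hw)
  few_timeouts := h.few_timeouts
  round_eq_zero := h.round_eq_zero
  evidence m hm := ⟨(h.evidence m hm).1.mono hs, (h.evidence m hm).2⟩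
  current_valid := h.current_valid
  creator_eq := h.creator_eq
  accepted_lt := h.accepted_lt
  creatorDeadline_le := h.creatorDeadline_le.trans (by gcongr)
  roundDeadline_le := h.roundDeadline_le.trans (by gcongr)
  le_roundDeadline := hr
  le_creatorDeadline := hc

/-- Timeouts are not negative. -/
def Params.Nonneg (par : Params n) : Prop :=
  ∀ v, 0 ≤ par.creatorTimeout v ∧ 0 ≤ par.roundTimeout v

theorem NodeInv.enter (hpos : par.Nonneg) {sent : Set (Msg n Tx)} {v : Fin n} {t : ℝ}
    {s : NodeState n Tx} (h : NodeInv par byz sent v t s) {r : ℕ} {P : Position n Tx}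
    {m : Msg n Tx} {T : Finset (Fin n × ℕ)} {A : Set (Result n Tx)}
    (hT : ∀ w r, (w, r) ∈ T → w ∉ byz → .timeout w r ∈ sent)
    (hfew : ∀ r', r ≤ r' → (NodeState.timeoutIssuers { s with timeouts := T } r').card
      < 2 * par.f + 1)
    (hm : Credible par.f byz sent m ∧ Evidence par.f m r) (hP : PositionValid par.f P)
    (hA : ∀ res ∈ A, res.round < r) :
    NodeInv par byz sent v t
      (NodeState.enter par v t r P m { s with timeouts := T, accepted := A }) where
  permits_valid := h.permits_valid
  permits_sent := h.permits_sent
  timeouts_sent := hT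
  few_timeouts := hfew
  round_eq_zero h := by simp [NodeState.enter] at h
  evidence m' hm' := by
    obtain rfl : m = m' := by simpa [NodeState.enter] using hm'
    exact hm
  current_valid := hP
  creator_eq h := h
  accepted_lt := hA
  creatorDeadline_le := le_rfl
  roundDeadline_le := le_rfl
  le_roundDeadline := le_add_of_nonneg_right (hpos v).2
  le_creatorDeadline _ := le_add_of_nonneg_right (hpos v).1

theorem NodeInv.accept (hpos : par.Nonneg) {sent : Set (Msg n Tx)} {v : Fin n} {t : ℝ}
    {s : NodeState n Tx} (h : NodeInv par byz sent v t s) {res : Result n Tx}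
    (hv : res.Valid par.f) (hr : s.round ≤ res.round)
    (hcred : Credible par.f byz sent (.result res)) :
    NodeInv par byz sent v t (s.accept par v t res) := by
  refine h.enter hpos h.timeouts_sent
    (fun r' hr' => h.few_timeouts r' (by omega)) ⟨hcred, hv, rfl⟩ hv.positionValid ?_
  rintro res' (rfl | hres')
  · exact Nat.lt_succ_self _
  · have := h.accepted_lt res' hres'
    omega

theorem NodeInv.localStep (hpos : par.Nonneg) {sent sent' : Set (Msg n Tx)} {v : Fin n} {t : ℝ}
    {s s' : NodeState n Tx} {out : Out n Tx} (hi : NodeInv par byz sent v t s)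
    (h : LocalStep par byz sent v t s s' out) (hs : sent ⊆ sent')
    (hout : ∀ x ∈ out, x.2 ∈ sent') : NodeInv par byz sent' v t s' := by
  have hi' : NodeInv par byz sent' v t s := hi.mono hs le_rfl hi.le_roundDeadline
    hi.le_creatorDeadline
  have key : ∀ T : Finset (Fin n × ℕ),
      (∀ q ∈ T, q ∈ s.timeouts ∨ (q.1 ∉ byz → .timeout q.1 q.2 ∈ sent)) →
      ∀ w r, (w, r) ∈ T → w ∉ byz → .timeout w r ∈ sent' := fun T hT w r hq hw =>
    (hT _ hq).elim (fun hq => hi'.timeouts_sent w r hq hw) fun hq => hs (hq hw)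
  cases h with
  | learnPermits Q hsub hQ =>
    exact { hi' with
      permits_valid := fun w r P hq =>
        (hQ _ hq).elim (fun hq => hi'.permits_valid w r P hq) fun hq => hq.1
      permits_sent := fun w r P hq hw =>
        (hQ _ hq).elim (fun hq => hi'.permits_sent w r P hq hw) fun hq => hs (hq.2 hw) }
  | learnTimeouts T out hsub hT hfew _ =>
    exact { hi' with timeouts_sent := key T hT, few_timeouts := hfew }
  | advance T r S out hsub hT hr hS hcard hmax hsubout _ =>
    refine hi'.enter hpos (key T hT) (fun r' hr' => ?_)
      ⟨fun w hw => key T hT w r (hS w hw), rfl, hcard⟩ hi.current_valid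
      (fun res hres => ?_)
    · by_contra hlt
      have := hmax r' (not_lt.1 hlt)
      omega
    · have := hi.accepted_lt res hres
      omega
  | receive res hv hr hcred => exact hi'.accept hpos hv hr (hcred.mono hs)
  | create res hc hv hr hsup hprop =>
    refine hi'.accept hpos hv hr.ge fun _ => ⟨fun _ => hout (v, .result res) (.inl rfl), ?_⟩
    intro q hq hqb
    rw [hr]
    exact hi'.permits_sent _ _ _ (hsup q hq) hqb
  | giveUp hc ht hb hfew =>
    exact { hi' with creator_eq := fun h => h.elim, le_creatorDeadline := fun h => h.elim }
  | roundTimeout ht =>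
    exact { hi' with
      roundDeadline_le := le_rfl
      le_roundDeadline := le_add_of_nonneg_right (hpos v).2 }

/-- The invariant of the global state. -/
structure Inv (par : Params n) (byz : Finset (Fin n)) (S : State n Tx) : Prop where
  transit : ∀ e ∈ S.inTransit, e.dst ∉ byz ∧ e.msg ∈ S.sent
  credible : ∀ m ∈ S.sent, Credible par.f byz S.sent m
  node : ∀ v, v ∉ byz → NodeInv par byz S.sent v S.now (S.node v)
  permit_sent : ∀ v, v ∉ byz → ∀ r P, .permit v r P ∈ S.sent →
    r ≤ (S.node v).round ∧ PositionValid par.f P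
  timeout_sent : ∀ v, v ∉ byz → ∀ r, .timeout v r ∈ S.sent → r ≤ (S.node v).round
  result_sent : ∀ res, .result res ∈ S.sent → res.Valid par.f → creator n res.round ∉ byz →
    res.round < (S.node (creator n res.round)).round
  result_unique : ∀ res res', .result res ∈ S.sent → .result res' ∈ S.sent → res.Valid par.f →
    res'.Valid par.f → creator n res.round ∉ byz → res.round = res'.round → res = res'

theorem inv_initialState (hpos : par.Nonneg) :
    Inv par byz (initialState par byz : State n Tx) where
  transit e he := by
    simp only [initialState, Set.mem_iUnion, envelopes, permitOut] at he
    obtain ⟨v, hv, he⟩ := he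
    obtain ⟨rfl, -, hd, hm⟩ := he
    rw [Set.mem_singleton_iff, Prod.mk.injEq] at hm
    exact ⟨hd, _, hv, hm.2⟩
  credible := by
    rintro m ⟨v, hv, rfl⟩ -
    exact ⟨v, hv, rfl⟩
  node v hv :=
    { permits_valid := by simp [initialState]
      permits_sent := by simp [initialState]
      timeouts_sent := by simp [initialState]
      few_timeouts := by simp [initialState, NodeState.timeoutIssuers]
      round_eq_zero := by simp [initialState]
      evidence := by simp [initialState]
      current_valid := positionValid_genesis _
      creator_eq := fun h => h
      accepted_lt := by simp [initialState]
      creatorDeadline_le := by simp [initialState]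
      roundDeadline_le := by simp [initialState]
      le_roundDeadline := (hpos v).2
      le_creatorDeadline := fun _ => (hpos v).1 }
  permit_sent := by
    rintro v hv r P ⟨w, hw, h⟩
    obtain ⟨rfl, rfl, rfl⟩ := Msg.permit.inj h
    exact ⟨le_rfl, positionValid_genesis _⟩
  timeout_sent := by
    rintro v hv r ⟨w, hw, h⟩
    cases h
  result_sent := by
    rintro res ⟨w, hw, h⟩
    cases h
  result_unique := by
    rintro res res' ⟨w, hw, h⟩
    cases h

theorem Inv.update (hpos : par.Nonneg) {S : State n Tx} (hS : Inv par byz S) {v : Fin n}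
    (hv : v ∉ byz) {s : NodeState n Tx} {out : Out n Tx}
    (h : LocalStep par byz S.sent v S.now (S.node v) s out) {I : Set (Envelope n Tx)}
    (hI : I ⊆ S.inTransit) :
    Inv par byz (State.update byz { S with inTransit := I } v s out) := by
  have hsub : S.sent ⊆ (State.update byz { S with inTransit := I } v s out).sent :=
    Set.subset_union_left
  have hvS := hS.node v hv
  have hle : ∀ w, (S.node w).round ≤
      ((State.update byz { S with inTransit := I } v s out).node w).round := fun w => by
    rcases eq_or_ne w v with rfl | hw
    · simpa [State.update] using h.round_le
    · simp [State.update, hw]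
  have hnv : (State.update byz { S with inTransit := I } v s out).node v = s := by
    simp [State.update]
  have hnode : NodeInv par byz (State.update byz { S with inTransit := I } v s out).sent v
      S.now s := hvS.localStep hpos h hsub fun x hx => .inr ⟨x.1, hx⟩
  -- A valid result of an honest creator is either an old one or just created by `v`.
  have hres : ∀ res, .result res ∈ (State.update byz { S with inTransit := I } v s out).sent →
      res.Valid par.f → creator n res.round ∉ byz → .result res ∈ S.sent ∨
      (.result res ∉ S.sent ∧ creator n res.round = v ∧ res.round = (S.node v).round ∧
        s.round = res.round + 1 ∧ (v, .result res) ∈ out ∧ ∀ w, (w, .result res) ∈ out) := by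
    intro res hmem hval hc
    by_cases hmem' : .result res ∈ S.sent
    · exact .inl hmem'
    obtain ⟨w, hw⟩ := hmem.resolve_left hmem'
    rcases h.mem_out hw with hl | ⟨-, hl⟩ | ⟨-, hl⟩ | ⟨_, _, hl, -⟩ |
      ⟨res', hl, hcr, -, hr, hr', -, -, hall⟩
    · exact absurd (((hvS.evidence _ hl).1 hval).1 hc) hmem'
    · cases hl
    · cases hl
    · cases hl
    · cases hl
      exact .inr ⟨hmem', by rw [hr]; exact hvS.creator_eq hcr, hr, by omega, hall v, hall⟩
  refine ⟨?_, ?_, ?_, ?_, ?_, ?_, ?_⟩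
  · rintro e (he | ⟨-, -, hd, hm⟩)
    · exact ⟨(hS.transit e (hI he)).1, hsub (hS.transit e (hI he)).2⟩
    · exact ⟨hd, .inr ⟨_, hm⟩⟩
  · rintro m (hm | ⟨w, hm⟩)
    · exact (hS.credible m hm).mono hsub
    · have hm' : m ∈ (State.update byz { S with inTransit := I } v s out).sent := .inr ⟨w, hm⟩
      rcases h.mem_out hm with hl | ⟨-, rfl⟩ | ⟨-, rfl⟩ | ⟨r, T, rfl, hT⟩ |
        ⟨res, rfl, -, -, hr, -, hsup, -, -⟩
      · exact (hvS.evidence _ hl).1.mono hsub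
      · exact fun _ => hm'
      · exact fun _ => hm'
      · exact fun w hw hwb => hnode.timeouts_sent w r (hT w hw) hwb
      · refine fun _ => ⟨fun _ => hm', fun q hq hqb => ?_⟩
        rw [hr]
        exact hsub (hvS.permits_sent _ _ _ (hsup q hq) hqb)
  · intro w hw
    rcases eq_or_ne w v with rfl | hwv
    · rw [hnv]
      exact hnode
    · have := (hS.node w hw).mono hsub le_rfl (hS.node w hw).le_roundDeadline
        (hS.node w hw).le_creatorDeadline
      simpa [State.update, hwv] using this
  · rintro w hw r P (hm | ⟨x, hm⟩)
    · exact ⟨(hS.permit_sent w hw r P hm).1.trans (hle w), (hS.permit_sent w hw r P hm).2⟩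
    · rcases h.mem_out hm with hl | ⟨-, hl⟩ | ⟨-, hl⟩ | ⟨_, _, hl, -⟩ | ⟨_, hl, -⟩
      · exact ((hvS.evidence _ hl).2).elim
      · obtain ⟨rfl, rfl, rfl⟩ := Msg.permit.inj hl
        rw [hnv]
        exact ⟨le_rfl, hnode.current_valid⟩
      all_goals cases hl
  · rintro w hw r (hm | ⟨x, hm⟩)
    · exact (hS.timeout_sent w hw r hm).trans (hle w)
    · rcases h.mem_out hm with hl | ⟨-, hl⟩ | ⟨-, hl⟩ | ⟨_, _, hl, -⟩ | ⟨_, hl, -⟩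
      · exact ((hvS.evidence _ hl).2).elim
      · cases hl
      · obtain ⟨rfl, rfl⟩ := Msg.timeout.inj hl
        exact hle w
      all_goals cases hl
  · intro res hm hval hc
    rcases hres res hm hval hc with hold | ⟨-, hcv, -, hr, -⟩
    · exact (hS.result_sent res hold hval hc).trans_le (hle _)
    · rw [hcv, hnv]
      omega
  · intro res res' hm hm' hval hval' hc hrr
    have hc' : creator n res'.round ∉ byz := hrr ▸ hc
    rcases hres res hm hval hc with hold | ⟨hnew, hcv, hrv, -, hout, hall⟩ <;>
    rcases hres res' hm' hval' hc' with hold' | ⟨hnew', hcv', hrv', -, hout', hall'⟩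
    · exact hS.result_unique res res' hold hold' hval hval' hc hrr
    · have := hS.result_sent res hold hval hc
      rw [hrr, hcv'] at this
      omega
    · have := hS.result_sent res' hold' hval' hc'
      rw [← hrr, hcv] at this
      omega
    · -- Both are new, but a local step sends at most one result that it creates.
      cases h with
      | learnPermits => exact absurd hout (Set.notMem_empty _)
      | giveUp => exact absurd hout (Set.notMem_empty _)
      | learnTimeouts T out hsub hT hfew hl =>
        exact absurd (((hvS.evidence _ (hl _ hout)).1 hval).1 hc) hnew
      | advance T r S out hsub hT hr hS hcard hmax hsubout hl =>
        rcases hl _ hout with hl | hl | hl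
        · cases hl
        · cases hl
        · exact absurd (((hvS.evidence _ hl).1 hval).1 hc) hnew
      | receive res hv hr hcred =>
        rw [permitOut, Set.mem_singleton_iff] at hout
        cases hout
      | create res₀ =>
        have huniq : ∀ res, (v, Msg.result res) ∈ ({x | x.2 = .result res₀} ∪
            permitOut v (res₀.round + 1) res₀.position : Out n Tx) → res = res₀ := by
          rintro res (h | h)
          · exact Msg.result.inj h
          · rw [permitOut, Set.mem_singleton_iff] at h
            cases h
        rw [huniq res hout, huniq res' hout']
      | roundTimeout => cases hout

/-- Every step of the system is the passing of time or a local step of one honest node. -/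
theorem Inv.step_cases {S S' : State n Tx} (hS : Inv par byz S) (h : Step par byz S S') :
    (∃ t, S.now ≤ t ∧ (∀ v, v ∉ byz → ¬ (S.node v).CanCreateBlock par) ∧
      (∀ v, v ∉ byz → (S.node v).creating → t ≤ (S.node v).creatorDeadline) ∧
      (∀ v, v ∉ byz → t ≤ (S.node v).roundDeadline) ∧ S' = { S with now := t }) ∨
    ∃ v s out I, v ∉ byz ∧ LocalStep par byz S.sent v S.now (S.node v) s out ∧
      I ⊆ S.inTransit ∧ S' = State.update byz { S with inTransit := I } v s out := by
  cases h with
  | tick t ht hb hc hr => exact .inl ⟨t, ht, hb, hc, hr, rfl⟩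
  | deliver e he s out h =>
    exact .inr ⟨e.dst, s, out, _, (hS.transit e he).1,
      h.localStep (hS.credible _ (hS.transit e he).2), Set.sdiff_subset, rfl⟩
  | byzantine w v hw hv m hm s out h =>
    exact .inr ⟨v, s, out, S.inTransit, hv, h.localStep (hm.credible par.f), le_rfl, rfl⟩
  | act v hv s out h =>
    exact .inr ⟨v, s, out, S.inTransit, hv, h.localStep (hS.node v hv).permits_valid, le_rfl, rfl⟩

theorem Inv.step (hpos : par.Nonneg) {S S' : State n Tx} (hS : Inv par byz S)
    (h : Step par byz S S') : Inv par byz S' := by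
  rcases hS.step_cases h with ⟨t, ht, -, hc, hr, rfl⟩ | ⟨v, s, out, I, hv, hl, hI, rfl⟩
  · exact { hS with
      node := fun v hv => (hS.node v hv).mono le_rfl ht (hr v hv) (hc v hv) }
  · exact hS.update hpos hv hl hI

/-! ### Steps of an execution -/

theorem exists_last_of_not {p : ℕ → Prop} {j k : ℕ} (hj : p j) (hk : ¬ p k) (hjk : j ≤ k) :
    ∃ i, j ≤ i ∧ i < k ∧ p i ∧ ¬ p (i + 1) := by
  induction k, hjk using Nat.le_induction with
  | base => exact absurd hj hk
  | succ k hjk ih =>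
    by_cases hk' : p k
    · exact ⟨k, hjk, Nat.lt_succ_self k, hk', hk⟩
    · obtain ⟨i, h1, h2, h3⟩ := ih hk'
      exact ⟨i, h1, by omega, h3⟩

namespace Execution

variable (E : Execution par byz Tx)

theorem inv (hpos : par.Nonneg) (k : ℕ) : Inv par byz (E.state k) := by
  induction k with
  | zero =>
    rw [E.start]
    exact inv_initialState hpos
  | succ k ih => exact ih.step hpos (E.step k)

/-- The local step of the honest node `v` that turns the `k`-th state into the next one, with the
messages `out` that are sent. -/
structure Takes (k : ℕ) (v : Fin n) (out : Out n Tx) : Prop where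
  honest : v ∉ byz
  now_eq : (E.state (k + 1)).now = (E.state k).now
  local_step : LocalStep par byz (E.state k).sent v (E.state k).now ((E.state k).node v)
    ((E.state (k + 1)).node v) out
  node_eq : ∀ w, w ≠ v → (E.state (k + 1)).node w = (E.state k).node w
  sent_eq : (E.state (k + 1)).sent = (E.state k).sent ∪ {m | ∃ w, (w, m) ∈ out}
  envelopes_subset : envelopes byz v (E.state k).now out ⊆ (E.state (k + 1)).inTransit

theorem tick_or_takes (hpos : par.Nonneg) (k : ℕ) :
    ((E.state k).now ≤ (E.state (k + 1)).now ∧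
      (∀ v, v ∉ byz → ¬ ((E.state k).node v).CanCreateBlock par) ∧
      (E.state (k + 1)).node = (E.state k).node ∧ (E.state (k + 1)).sent = (E.state k).sent) ∨
    ∃ v out, E.Takes k v out := by
  rcases (E.inv hpos k).step_cases (E.step k) with
    ⟨t, ht, hb, -, -, h⟩ | ⟨v, s, out, I, hv, hl, hI, h⟩
  · rw [h]
    exact .inl ⟨ht, hb, rfl, rfl⟩
  · refine .inr ⟨v, out, hv, ?_, ?_, ?_, ?_, ?_⟩
    · rw [h]; rfl
    · rw [h]; simpa [State.update] using hl
    · rw [h]; intro w hw; simp [State.update, hw]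
    · rw [h]; rfl
    · rw [h]; exact Set.subset_union_right

/-- Seen from one node, a step leaves its local state unchanged or is its own local step. -/
theorem node_eq_or_takes (hpos : par.Nonneg) (k : ℕ) (v : Fin n) :
    (E.state (k + 1)).node v = (E.state k).node v ∨ ∃ out, E.Takes k v out := by
  rcases E.tick_or_takes hpos k with ⟨-, -, h, -⟩ | ⟨w, out, h⟩
  · exact .inl (congrFun h v)
  · rcases eq_or_ne v w with rfl | hvw
    · exact .inr ⟨out, h⟩
    · exact .inl (h.node_eq v hvw)

theorem now_mono (hpos : par.Nonneg) {i k : ℕ} (h : i ≤ k) :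
    (E.state i).now ≤ (E.state k).now := by
  refine monotone_nat_of_le_succ (f := fun k => (E.state k).now) (fun k => ?_) h
  rcases E.tick_or_takes hpos k with h | ⟨w, out, h⟩
  · exact h.1
  · exact h.now_eq.ge

theorem sent_mono (hpos : par.Nonneg) : Monotone fun k => (E.state k).sent := by
  refine monotone_nat_of_le_succ fun k => ?_
  rcases E.tick_or_takes hpos k with h | ⟨w, out, h⟩
  · exact h.2.2.2.ge
  · exact h.sent_eq ▸ Set.subset_union_left

theorem round_mono (hpos : par.Nonneg) (v : Fin n) {i k : ℕ} (h : i ≤ k) :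
    ((E.state i).node v).round ≤ ((E.state k).node v).round := by
  refine monotone_nat_of_le_succ (f := fun k => ((E.state k).node v).round) (fun k => ?_) h
  rcases E.node_eq_or_takes hpos k v with h | ⟨out, h⟩
  · rw [h]
  · exact h.local_step.round_le

theorem permits_mono (hpos : par.Nonneg) (v : Fin n) :
    Monotone fun k => ((E.state k).node v).permits := by
  refine monotone_nat_of_le_succ fun k => ?_
  rcases E.node_eq_or_takes hpos k v with h | ⟨out, h⟩
  · rw [h]
  · exact h.local_step.permits_subset

theorem timeouts_mono (hpos : par.Nonneg) (v : Fin n) :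
    Monotone fun k => ((E.state k).node v).timeouts := by
  refine monotone_nat_of_le_succ fun k => ?_
  rcases E.node_eq_or_takes hpos k v with h | ⟨out, h⟩
  · rw [h]
  · exact h.local_step.timeouts_subset

theorem acceptedProposals_mono (hpos : par.Nonneg) : Monotone E.acceptedProposals := by
  refine monotone_nat_of_le_succ fun k => ?_
  rintro p ⟨v, hv, hp⟩
  refine ⟨v, hv, ?_⟩
  rcases E.node_eq_or_takes hpos k v with h | ⟨out, h⟩
  · rwa [h]
  · exact h.local_step.accepted_subset hp

/-- Time exceeds every bound, so no bound on the time can hold from some step on. -/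
theorem exists_now_gt (k : ℕ) (t : ℝ) : ∃ i, k ≤ i ∧ t < (E.state i).now :=
  ((eventually_ge_atTop k).and (E.diverges.eventually_gt_atTop t)).exists

theorem exists_takes_of_notMem_sent (hpos : par.Nonneg) {k : ℕ} {m : Msg n Tx}
    (h : m ∈ (E.state (k + 1)).sent) (h' : m ∉ (E.state k).sent) :
    ∃ v out w, E.Takes k v out ∧ (w, m) ∈ out := by
  rcases E.tick_or_takes hpos k with ht | ⟨v, out, ht⟩
  · exact absurd (ht.2.2.2 ▸ h) h'
  · rw [ht.sent_eq] at h
    obtain ⟨w, hw⟩ := h.resolve_left h'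
    exact ⟨v, out, w, ht, hw⟩

theorem new_permit (hpos : par.Nonneg) {k : ℕ} {v : Fin n} {r : ℕ}
    {P : Position n Tx} (h : .permit v r P ∈ (E.state (k + 1)).sent)
    (h' : .permit v r P ∉ (E.state k).sent) :
    ((E.state k).node v).round < ((E.state (k + 1)).node v).round ∧
      r = ((E.state (k + 1)).node v).round ∧ P = ((E.state (k + 1)).node v).current := by
  obtain ⟨u, out, w, ht, hw⟩ := E.exists_takes_of_notMem_sent hpos h h'
  rcases ht.local_step.mem_out hw with hl | ⟨hlt, hl⟩ | ⟨-, hl⟩ | ⟨_, _, hl, -⟩ | ⟨_, hl, -⟩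
  · exact ((((E.inv hpos k).node u ht.honest).evidence _ hl).2).elim
  · obtain ⟨rfl, rfl, rfl⟩ := Msg.permit.inj hl
    exact ⟨hlt, rfl, rfl⟩
  all_goals cases hl

theorem new_timeout (hpos : par.Nonneg) {k : ℕ} {v : Fin n} {r : ℕ}
    (h : .timeout v r ∈ (E.state (k + 1)).sent) (h' : .timeout v r ∉ (E.state k).sent) :
    ((E.state k).node v).roundDeadline ≤ (E.state k).now ∧ r = ((E.state k).node v).round := by
  obtain ⟨u, out, w, ht, hw⟩ := E.exists_takes_of_notMem_sent hpos h h'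
  rcases ht.local_step.mem_out hw with hl | ⟨-, hl⟩ | ⟨hd, hl⟩ | ⟨_, _, hl, -⟩ | ⟨_, hl, -⟩
  · exact ((((E.inv hpos k).node u ht.honest).evidence _ hl).2).elim
  · cases hl
  · obtain ⟨rfl, rfl⟩ := Msg.timeout.inj hl
    exact ⟨hd, rfl⟩
  all_goals cases hl

/-- In the `k`-th step, the honest creator `v` creates the result `res` and sends it to all. -/
structure Creates (k : ℕ) (v : Fin n) (res : Result n Tx) : Prop where
  round_eq : ((E.state k).node v).round = res.round
  deadline_le : ∀ p, res = .proposal p → ((E.state k).node v).creatorDeadline ≤ (E.state k).now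
  transit : ∀ w, w ∉ byz →
    (⟨v, w, .result res, (E.state k).now⟩ : Envelope n Tx) ∈ (E.state (k + 1)).inTransit

theorem new_result (hpos : par.Nonneg) {k : ℕ} {res : Result n Tx} (hval : res.Valid par.f)
    (hc : creator n res.round ∉ byz) (h : .result res ∈ (E.state (k + 1)).sent)
    (h' : .result res ∉ (E.state k).sent) : E.Creates k (creator n res.round) res := by
  obtain ⟨u, out, w, ht, hw⟩ := E.exists_takes_of_notMem_sent hpos h h'
  have hu := (E.inv hpos k).node u ht.honest
  rcases ht.local_step.mem_out hw with hl | ⟨-, hl⟩ | ⟨-, hl⟩ | ⟨_, _, hl, -⟩ |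
    ⟨res', hl, hcr, -, hr, -, -, hprop, hall⟩
  · exact absurd (((hu.evidence _ hl).1 hval).1 hc) h'
  · cases hl
  · cases hl
  · cases hl
  · cases hl
    have hcu : creator n res.round = u := by
      rw [hr]
      exact hu.creator_eq hcr
    rw [hcu]
    exact ⟨hr.symm, hprop, fun w hw =>
      ht.envelopes_subset ⟨rfl, rfl, hw, hall w⟩⟩

/-- In the `k`-th step, node `v` accepts the result `res` and starts the round after it. -/
structure AcceptsResult (k : ℕ) (v : Fin n) (res : Result n Tx) : Prop where
  valid : res.Valid par.f
  round_le : ((E.state k).node v).round ≤ res.round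
  round_eq : ((E.state (k + 1)).node v).round = res.round + 1
  current_eq : ((E.state (k + 1)).node v).current = res.position
  mem_accepted : res ∈ ((E.state (k + 1)).node v).accepted
  sent : creator n res.round ∉ byz → .result res ∈ (E.state (k + 1)).sent
  support_sent : ∀ q ∈ res.support, q.1 ∉ byz → .permit q.1 res.round q.2 ∈ (E.state k).sent

/-- In the `k`-th step, node `v` leaves round `r` with the help of timeout messages of the nodes
in `S`. -/
structure LeavesByTimeout (k : ℕ) (v : Fin n) (r : ℕ) (S : Finset (Fin n)) : Prop where
  card_eq : S.card = 2 * par.f + 1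
  round_eq : ((E.state (k + 1)).node v).round = r + 1
  sent : ∀ w ∈ S, w ∉ byz → .timeout w r ∈ (E.state k).sent
  transit : ∀ w, w ∉ byz → w ≠ v →
    (⟨v, w, .timeouts r S, (E.state k).now⟩ : Envelope n Tx) ∈ (E.state (k + 1)).inTransit

/-- A node that starts a new round sends a permit to its creator, and it has either accepted a
result of the previous round or left that round by timeout. -/
theorem starts_round (hpos : par.Nonneg) {k : ℕ} {v : Fin n}
    (h : ((E.state k).node v).round < ((E.state (k + 1)).node v).round) :
    (E.state (k + 1)).now = (E.state k).now ∧
    (∀ w, w ∉ byz → creator n ((E.state (k + 1)).node v).round = w →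
      (⟨v, w, .permit v ((E.state (k + 1)).node v).round ((E.state (k + 1)).node v).current,
        (E.state k).now⟩ : Envelope n Tx) ∈ (E.state (k + 1)).inTransit) ∧
    ((∃ res, E.AcceptsResult k v res) ∨ ∃ r S, E.LeavesByTimeout k v r S) := by
  rcases E.node_eq_or_takes hpos k v with heq | ⟨out, ht⟩
  · rw [heq] at h
    exact absurd h (lt_irrefl _)
  have hinv := (E.inv hpos k).node v ht.honest
  have hl := ht.local_step
  have hsub := ht.envelopes_subset
  refine ⟨ht.now_eq, ?_⟩
  obtain ⟨s', hs'⟩ : ∃ s', (E.state (k + 1)).node v = s' := ⟨_, rfl⟩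
  rw [hs'] at hl h
  cases hl with
  | learnPermits => exact absurd h (lt_irrefl _)
  | learnTimeouts => exact absurd h (lt_irrefl _)
  | giveUp => exact absurd h (lt_irrefl _)
  | roundTimeout => exact absurd h (lt_irrefl _)
  | advance T r S out hsT hT hr hS hcard hmax hsubout _ =>
    refine ⟨?_, .inr ⟨r, S, hcard, by rw [hs']; rfl, fun w hw hwb => ?_, ?_⟩⟩
    · rintro w hw rfl
      exact hsub ⟨rfl, rfl, hw, hsubout (.inr (by rw [hs']; rfl))⟩
    · exact (hT _ (hS w hw)).elim (fun hq => hinv.timeouts_sent w r hq hwb) fun hq => hq hwb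
    · exact fun w hw hwv => hsub ⟨rfl, rfl, hw, hsubout (.inl ⟨hwv, rfl⟩)⟩
  | receive res hv hr hcred =>
    refine ⟨?_, .inl ⟨res, hv, hr, by rw [hs']; rfl, by rw [hs']; rfl,
      by rw [hs']; exact Set.mem_insert _ _, fun hc => ?_, (hcred hv).2⟩⟩
    · rintro w hw rfl
      exact hsub ⟨rfl, rfl, hw, by rw [hs']; rfl⟩
    · exact E.sent_mono hpos (Nat.le_succ k) ((hcred hv).1 hc)
  | create res hc hv hr hsup hprop =>
    refine ⟨?_, .inl ⟨res, hv, hr.ge, by rw [hs']; rfl, by rw [hs']; rfl,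
      by rw [hs']; exact Set.mem_insert _ _, fun _ => ?_, fun q hq hqb => ?_⟩⟩
    · rintro w hw rfl
      exact hsub ⟨rfl, rfl, hw, .inr (by rw [hs']; rfl)⟩
    · rw [ht.sent_eq]
      exact .inr ⟨v, .inl rfl⟩
    · rw [hr]
      exact hinv.permits_sent _ _ _ (hsup q hq) hqb

/-! ### The first node in a round -/

/-- All honest nodes are in rounds before `r`. -/
def Below (k r : ℕ) : Prop := ∀ v, v ∉ byz → ((E.state k).node v).round < r

theorem Below.of_le (hpos : par.Nonneg) {k k' r : ℕ} (h : E.Below k' r) (hk : k ≤ k') :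
    E.Below k r :=
  fun v hv => (E.round_mono hpos v hk).trans_lt (h v hv)

theorem exists_first (hpos : par.Nonneg) {j k r : ℕ} (hj : E.Below j r) (hk : ¬ E.Below k r) :
    ∃ i, j ≤ i ∧ i < k ∧ E.Below i r ∧ ¬ E.Below (i + 1) r :=
  exists_last_of_not (p := fun i => E.Below i r) hj hk
    (le_of_not_ge fun hkj => hk (hj.of_le E hpos hkj))

theorem exists_start_round {v : Fin n} {j k r : ℕ} (hj : ((E.state j).node v).round < r)
    (hk : r ≤ ((E.state k).node v).round) (hjk : j ≤ k) :
    ∃ i, j ≤ i ∧ i < k ∧ ((E.state i).node v).round < r ∧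
      r ≤ ((E.state (i + 1)).node v).round := by
  simpa only [not_lt] using exists_last_of_not (p := fun i => ((E.state i).node v).round < r) hj
    (not_lt.2 hk) hjk

theorem AcceptsResult.exists_round_le (hpos : par.Nonneg) (hbyz : byz.card ≤ par.f) {k : ℕ}
    {v : Fin n} {res : Result n Tx} (h : E.AcceptsResult k v res) :
    ∃ u, u ∉ byz ∧ res.round ≤ ((E.state k).node u).round := by
  obtain ⟨q, hq, hqb⟩ := h.valid.exists_honest hbyz
  exact ⟨q.1, hqb, ((E.inv hpos k).permit_sent _ hqb _ _ (h.support_sent q hq hqb)).1⟩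

theorem LeavesByTimeout.exists_honest (hbyz : byz.card ≤ par.f) {k : ℕ} {v : Fin n} {r : ℕ}
    {S : Finset (Fin n)} (h : E.LeavesByTimeout k v r S) :
    ∃ u, u ∉ byz ∧ .timeout u r ∈ (E.state k).sent := by
  obtain ⟨u, hu, hub⟩ := exists_honest_of_card (byz := byz) (S := S) (by have := h.card_eq; omega)
  exact ⟨u, hub, h.sent u hu hub⟩

/-- Results and timeout bundles contain signatures of honest nodes that have been in their round.
Hence no round is skipped by all honest nodes. -/
theorem round_eq_of_first (hpos : par.Nonneg) (hbyz : byz.card ≤ par.f) {k r : ℕ}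
    (hk : E.Below k r) {v : Fin n} (hv : v ∉ byz) (hr : r ≤ ((E.state (k + 1)).node v).round) :
    ((E.state (k + 1)).node v).round = r := by
  obtain ⟨-, -, ⟨res, h⟩ | ⟨r', S, h⟩⟩ := E.starts_round hpos ((hk v hv).trans_le hr)
  · obtain ⟨u, hu, hle⟩ := h.exists_round_le E hpos hbyz
    have := hk u hu
    have := h.round_eq
    omega
  · obtain ⟨u, hu, hs⟩ := h.exists_honest E hbyz
    have := (E.inv hpos k).timeout_sent u hu r' hs
    have := hk u hu
    have := h.round_eq
    omega

/-- Nodes that have entered a round `≥ r` after the `j`-th step, when there were none, have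
restarted their timers since, and only an expired creator timer ends a creator phase early. -/
theorem timers_of_below (hpos : par.Nonneg) {j k r : ℕ} (hj : E.Below j r) (hjk : j ≤ k)
    {v : Fin n} (hv : v ∉ byz) (hr : r ≤ ((E.state k).node v).round) :
    (E.state j).now + par.roundTimeout v ≤ ((E.state k).node v).roundDeadline ∧
    (E.state j).now + par.creatorTimeout v ≤ ((E.state k).node v).creatorDeadline ∧
    (creator n ((E.state k).node v).round = v → ((E.state k).node v).creating ∨
      (E.state j).now + par.creatorTimeout v ≤ (E.state k).now) := by
  induction k, hjk using Nat.le_induction with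
  | base => exact absurd (hj v hv) (not_lt.2 hr)
  | succ k hjk ih =>
    have hnow : (E.state j).now ≤ (E.state k).now := E.now_mono hpos hjk
    have hnow' : (E.state k).now ≤ (E.state (k + 1)).now := E.now_mono hpos (Nat.le_succ k)
    rcases E.node_eq_or_takes hpos k v with heq | ⟨out, ht⟩
    · rw [heq] at hr ⊢
      obtain ⟨h1, h2, h3⟩ := ih hr
      exact ⟨h1, h2, fun h => (h3 h).imp_right fun h => h.trans hnow'⟩
    have hl := ht.local_step
    rw [ht.now_eq]
    generalize (E.state (k + 1)).node v = s' at hl hr ⊢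
    cases hl with
    | learnPermits => exact ih hr
    | learnTimeouts => exact ih hr
    | giveUp hc hd =>
      obtain ⟨h1, h2, -⟩ := ih hr
      exact ⟨h1, h2, fun _ => .inr (h2.trans hd)⟩
    | roundTimeout hd =>
      obtain ⟨h1, h2, h3⟩ := ih hr
      refine ⟨?_, h2, h3⟩
      dsimp only
      gcongr
    | advance =>
      refine ⟨?_, ?_, fun h => .inl h⟩ <;> dsimp only [NodeState.enter] <;> gcongr
    | receive =>
      refine ⟨?_, ?_, fun h => .inl h⟩ <;>
        dsimp only [NodeState.accept, NodeState.enter] <;> gcongr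
    | create =>
      refine ⟨?_, ?_, fun h => .inl h⟩ <;>
        dsimp only [NodeState.accept, NodeState.enter] <;> gcongr

/-- No timeout messages for rounds `≥ r` are sent for the duration of a round timeout after a state
in which these rounds have not been reached. -/
theorem timeout_notMem_sent (hpos : par.Nonneg) {j k r r' : ℕ} (hj : E.Below j r) {v : Fin n}
    (hv : v ∉ byz) (hr : r ≤ r')
    (ht : (E.state k).now < (E.state j).now + par.roundTimeout v) :
    .timeout v r' ∉ (E.state k).sent := by
  rcases le_total k j with hkj | hjk
  · intro hs
    have := (E.inv hpos j).timeout_sent v hv r' (E.sent_mono hpos hkj hs)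
    have := hj v hv
    omega
  induction k, hjk using Nat.le_induction with
  | base =>
    intro hs
    have := (E.inv hpos j).timeout_sent v hv r' hs
    have := hj v hv
    omega
  | succ k hjk ih =>
    intro hs
    have ht' : (E.state k).now < (E.state j).now + par.roundTimeout v :=
      lt_of_le_of_lt (E.now_mono hpos (Nat.le_succ k)) ht
    obtain ⟨hd, rfl⟩ := E.new_timeout hpos hs (ih ht')
    have := (E.timers_of_below hpos hj hjk hv hr).1
    linarith

theorem LeavesByTimeout.lt_now (hpos : par.Nonneg) (hbyz : byz.card ≤ par.f) {D : ℝ}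
    (hD : ∀ v, D < par.roundTimeout v) {j k r r' : ℕ} (hj : E.Below j r) (hr : r ≤ r')
    {v : Fin n} {S : Finset (Fin n)} (h : E.LeavesByTimeout k v r' S) :
    (E.state j).now + D < (E.state k).now := by
  by_contra hlt
  obtain ⟨u, hu, hs⟩ := h.exists_honest E hbyz
  exact E.timeout_notMem_sent hpos hj hu hr (by linarith [hD u]) hs

/-! ### Message delivery -/

/-- In the `k`-th step, node `v` receives the message `m` and sends `out` in response. -/
structure Receives (k : ℕ) (v : Fin n) (m : Msg n Tx) (out : Out n Tx) : Prop where
  now_eq : (E.state (k + 1)).now = (E.state k).now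
  receive : Receive par v (E.state k).now ((E.state k).node v) m ((E.state (k + 1)).node v) out
  envelopes_subset : envelopes byz v (E.state k).now out ⊆ (E.state (k + 1)).inTransit

/-- A message leaves the network only by being delivered. -/
theorem transit_succ {k : ℕ} {e : Envelope n Tx} (he : e ∈ (E.state k).inTransit) :
    e ∈ (E.state (k + 1)).inTransit ∨ ∃ out, E.Receives k e.dst e.msg out := by
  have hs := E.step k
  generalize hS' : E.state (k + 1) = S' at hs
  cases hs with
  | tick => exact .inl he
  | deliver e' he' s out h =>
    by_cases hee : e = e'
    · subst hee
      refine .inr ⟨out, ?_, ?_, ?_⟩ <;> rw [hS']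
      · rfl
      · simpa [State.update] using h
      · exact Set.subset_union_right
    · exact .inl (.inl ⟨he, hee⟩)
  | byzantine => exact .inl (.inl he)
  | act => exact .inl (.inl he)

theorem exists_receives {Δ a b T : ℝ} (hsync : E.Synchronous Δ a b) (ha : a ≤ T) (hb : T + Δ ≤ b)
    {k : ℕ} {e : Envelope n Tx} (he : e ∈ (E.state k).inTransit) (hs : e.sentAt ≤ T) :
    ∃ i out, k ≤ i ∧ (E.state i).now ≤ T + Δ ∧ E.Receives i e.dst e.msg out := by
  by_contra! hcon
  have hmax : max e.sentAt a + Δ ≤ T + Δ := by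
    have := max_le hs ha
    linarith
  have key : ∀ i, k ≤ i → e ∈ (E.state i).inTransit ∧ (E.state i).now ≤ T + Δ := by
    intro i hi
    have hmem : e ∈ (E.state i).inTransit := by
      induction i, hi using Nat.le_induction with
      | base => exact he
      | succ i hi ih =>
        refine (E.transit_succ ih).resolve_right ?_
        rintro ⟨out, h⟩
        exact hcon i out hi ((hsync i e ih (hmax.trans hb)).trans hmax) h
    exact ⟨hmem, (hsync i e hmem (hmax.trans hb)).trans hmax⟩
  obtain ⟨i, hi, hlt⟩ := E.exists_now_gt k (T + Δ)
  exact absurd (key i hi).2 (not_le.2 hlt)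

end Execution

/-! ### Round-robin creators -/

/-- As less than a third of the nodes are byzantine, each window of `n` rounds contains the first of
three successive rounds with honest creators. -/
theorem exists_honest_creators (h : 3 * byz.card < n) (R : ℕ) :
    ∃ r, R ≤ r ∧ r < R + n ∧ creator n r ∉ byz ∧ creator n (r + 1) ∉ byz ∧
      creator n (r + 2) ∉ byz := by
  classical
  let bad : ℕ → Finset ℕ := fun c => (Finset.range n).filter fun i => creator n (R + i + c) ∈ byz
  have hbad : ∀ c, (bad c).card ≤ byz.card := fun c => by
    refine Finset.card_le_card_of_injOn (fun i => creator n (R + i + c))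
      (fun i hi => (Finset.mem_filter.1 hi).2) ?_
    intro i hi i' hi' hii
    have hi := Finset.mem_range.1 (Finset.mem_filter.1 hi).1
    have hi' := Finset.mem_range.1 (Finset.mem_filter.1 hi').1
    have hmod : R + i + c ≡ R + i' + c [MOD n] := congrArg Fin.val hii
    exact ((hmod.add_right_cancel' c).add_left_cancel' R).eq_of_lt_of_lt hi hi'
  have hcard : (bad 0 ∪ bad 1 ∪ bad 2).card < (Finset.range n).card := by
    have h1 := Finset.card_union_le (bad 0 ∪ bad 1) (bad 2)
    have h2 := Finset.card_union_le (bad 0) (bad 1)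
    have := hbad 0
    have := hbad 1
    have := hbad 2
    rw [Finset.card_range]
    omega
  obtain ⟨i, hi, hi'⟩ := Finset.exists_mem_notMem_of_card_lt_card hcard
  have hin := Finset.mem_range.1 hi
  simp only [bad, Finset.mem_union, Finset.mem_filter, hi, true_and, not_or] at hi'
  exact ⟨R + i, by omega, by omega, hi'.1.1, hi'.1.2, hi'.2⟩

namespace Execution

variable {E : Execution par byz Tx}

/-! ### Catching up during synchrony -/

/-- When an honest node is the first to leave a round with an honest creator, all honest nodes
leave it within `Δ`: the creator sends its block or proposal to all nodes, and whoever leaves by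
timeout forwards the timeout messages. -/
theorem spread (hpos : par.Nonneg) (hbyz : byz.card ≤ par.f) {Δ a b T : ℝ} (hΔ : 0 ≤ Δ)
    (hsync : E.Synchronous Δ a b) (ha : a ≤ T) (hb : T + Δ ≤ b) {j r : ℕ}
    (hr : creator n r ∉ byz) (hj : E.Below j (r + 1)) (hj' : ¬ E.Below (j + 1) (r + 1))
    (hT : (E.state j).now ≤ T) {w : Fin n} (hw : w ∉ byz) :
    ∃ i, j < i ∧ (E.state i).now ≤ T + Δ ∧ r + 1 ≤ ((E.state i).node w).round := by
  unfold Below at hj'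
  push Not at hj'
  obtain ⟨v, hv, hvr⟩ := hj'
  have hround := E.round_eq_of_first hpos hbyz hj hv hvr
  obtain ⟨hnow, -, ⟨res, h⟩ | ⟨r', S, h⟩⟩ := E.starts_round hpos ((hj v hv).trans_le hvr)
  · obtain rfl : r = res.round := by have := h.round_eq; omega
    have hnew : .result res ∉ (E.state j).sent := fun hs => by
      have := (E.inv hpos j).result_sent res hs h.valid hr
      have := hj _ hr
      omega
    obtain ⟨i, out, hi, hiT, hrec⟩ := E.exists_receives hsync ha hb
      ((E.new_result hpos h.valid hr (h.sent hr) hnew).transit w hw) hT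
    exact ⟨i + 1, by omega, hrec.now_eq.trans_le hiT, hrec.receive.lt_round_of_result h.valid⟩
  · obtain rfl : r = r' := by have := h.round_eq; omega
    rcases eq_or_ne w v with rfl | hwv
    · exact ⟨j + 1, Nat.lt_succ_self j, by linarith, hvr⟩
    · obtain ⟨i, out, hi, hiT, hrec⟩ := E.exists_receives hsync ha hb (h.transit w hw hwv) hT
      exact ⟨i + 1, by omega, hrec.now_eq.trans_le hiT,
        hrec.receive.lt_round_of_timeouts h.card_eq⟩

theorem state_zero_round (v : Fin n) : ((E.state 0).node v).round = 0 := by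
  rw [E.start]
  rfl

/-- Honest nodes lag behind by at most `n` rounds, because some of these have honest creators. -/
theorem lag_le (hpos : par.Nonneg) (hbyz : byz.card ≤ par.f) (hf : 3 * par.f < n)
    {Δ a b T : ℝ} (hΔ : 0 ≤ Δ)
    (hsync : E.Synchronous Δ a b) (ha : a ≤ T) (hb : T + Δ ≤ b) {j R : ℕ} {u : Fin n}
    (hu : u ∉ byz) (hR : R ≤ ((E.state j).node u).round) (hT : (E.state j).now ≤ T) {w : Fin n}
    (hw : w ∉ byz) :
    ∃ i, j ≤ i ∧ (E.state i).now ≤ T + Δ ∧ R ≤ ((E.state i).node w).round + n := by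
  by_cases hRn : R ≤ n
  · exact ⟨j, le_rfl, by linarith, by omega⟩
  obtain ⟨r, hr, hr', hc, -⟩ := exists_honest_creators (byz := byz) (by omega) (R - n)
  have h0 : E.Below 0 (r + 1) := fun v _ => by
    rw [E.state_zero_round v]
    omega
  have hj : ¬ E.Below j (r + 1) := fun h => by
    have := h u hu
    omega
  obtain ⟨i, -, hij, hi, hi'⟩ := E.exists_first hpos h0 hj
  obtain ⟨k, -, hkT, hk⟩ := spread hpos hbyz hΔ hsync ha hb hc hi hi'
    ((E.now_mono hpos hij.le).trans hT) hw
  refine ⟨max j k, le_max_left _ _, ?_, ?_⟩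
  · rcases le_total j k with h | h
    · rwa [max_eq_right h]
    · rw [max_eq_left h]
      linarith
  · have := E.round_mono hpos w (le_max_right j k)
    omega

/-- An honest node either starts a new round before its round timeout, or sends a timeout message
to all. -/
theorem starts_round_or_times_out (hpos : par.Nonneg) {v : Fin n} (hv : v ∉ byz) (j : ℕ) :
    ∃ k, j ≤ k ∧ (E.state k).now ≤ (E.state j).now + par.roundTimeout v ∧
      (((E.state j).node v).round < ((E.state k).node v).round ∨ ∀ w, w ∉ byz →
        (⟨v, w, .timeout v ((E.state j).node v).round, (E.state k).now⟩ : Envelope n Tx) ∈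
          (E.state (k + 1)).inTransit) := by
  by_contra! hcon
  -- Otherwise the round timer is never restarted, and time stops at its deadline.
  have key : ∀ k, j ≤ k → ((E.state k).node v).round = ((E.state j).node v).round ∧
      ((E.state k).node v).roundDeadline = ((E.state j).node v).roundDeadline := by
    intro k hk
    induction k, hk using Nat.le_induction with
    | base => exact ⟨rfl, rfl⟩
    | succ k hk ih =>
      have hle : (E.state k).now ≤ (E.state j).now + par.roundTimeout v :=
        ((E.inv hpos k).node v hv).le_roundDeadline.trans
          (ih.2.trans_le ((E.inv hpos j).node v hv).roundDeadline_le)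
      rcases E.node_eq_or_takes hpos k v with heq | ⟨out, ht⟩
      · rw [heq]
        exact ih
      have hl := ht.local_step
      have hsub := ht.envelopes_subset
      rcases hl.round_le.eq_or_lt with hround | hlt
      · have hnot := (hcon k hk hle).2
        obtain ⟨s', hs'⟩ : ∃ s', (E.state (k + 1)).node v = s' := ⟨_, rfl⟩
        rw [hs'] at hl hround ⊢
        cases hl with
        | learnPermits => exact ih
        | learnTimeouts => exact ih
        | giveUp => exact ih
        | roundTimeout hd =>
          obtain ⟨w, hw, hw'⟩ := hnot
          exact absurd (hsub ⟨rfl, rfl, hw, by rw [← ih.1]; rfl⟩) hw'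
        | advance T r S out hsT hT hr => exact absurd hround (Nat.lt_succ_of_le hr).ne
        | receive res hv hr => exact absurd hround (Nat.lt_succ_of_le hr).ne
        | create res hc hv hr => exact absurd hround (Nat.lt_succ_of_le hr.ge).ne
      · have := (hcon (k + 1) (by omega) (ht.now_eq.trans_le hle)).1
        omega
  obtain ⟨k, hk, hlt⟩ := E.exists_now_gt j ((E.state j).now + par.roundTimeout v)
  have h1 := ((E.inv hpos k).node v hv).le_roundDeadline
  have h2 := ((E.inv hpos j).node v hv).roundDeadline_le
  rw [(key k hk).2] at h1
  linarith

/-- All honest nodes catch up: a node that lags behind advances before its round timeout, or it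
sends a timeout message, to which the leading node replies with the evidence for its round. -/
theorem catch_up (hpos : par.Nonneg) (hbyz : byz.card ≤ par.f) (hf : 3 * par.f < n)
    {Δ a b T M : ℝ} (hΔ : 0 ≤ Δ) (hM : ∀ v, par.roundTimeout v ≤ M)
    (hsync : E.Synchronous Δ a b) (ha : a ≤ T) {j R : ℕ} {u : Fin n}
    (hu : u ∉ byz) (hR : R ≤ ((E.state j).node u).round) (hT : (E.state j).now ≤ T) {w : Fin n}
    (hw : w ∉ byz) (d : ℕ) (hb : T + Δ + d * (M + 2 * Δ) ≤ b) :
    ∃ i, j ≤ i ∧ (E.state i).now ≤ T + Δ + d * (M + 2 * Δ) ∧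
      R ≤ ((E.state i).node w).round + (n - d) := by
  have hM0 : 0 ≤ M := (hpos u).2.trans (hM u)
  induction d with
  | zero =>
    simp only [Nat.cast_zero, zero_mul, add_zero, Nat.sub_zero] at hb ⊢
    exact lag_le hpos hbyz hf hΔ hsync ha hb hu hR hT hw
  | succ d ih =>
    push_cast at hb ⊢
    have hd : (0 : ℝ) ≤ d * (M + 2 * Δ) := by positivity
    obtain ⟨i, hji, hi, hiR⟩ := ih (by linarith)
    by_cases hlow : R ≤ ((E.state i).node w).round
    · exact ⟨i, hji, by linarith, by omega⟩
    obtain ⟨k, hik, hk, hlt | hsend⟩ := starts_round_or_times_out (E := E) hpos hw i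
    · exact ⟨k, by omega, by linarith [hM w], by omega⟩
    obtain ⟨k₁, out, hk₁, hnow₁, hrec₁⟩ := E.exists_receives hsync
      (T := T + Δ + d * (M + 2 * Δ) + M) (by linarith) (by linarith) (hsend u hu)
      (by linarith [hM w])
    have hRu : R ≤ ((E.state k₁).node u).round := hR.trans (E.round_mono hpos u (by omega))
    have hinv := (E.inv hpos k₁).node u hu
    obtain ⟨m, hm⟩ : ∃ m, ((E.state k₁).node u).latest = some m := by
      rw [← Option.ne_none_iff_exists']
      intro hnone
      have := hinv.round_eq_zero hnone
      omega
    have hlt : ((E.state i).node w).round < ((E.state k₁).node u).round := by omega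
    have hout := hrec₁.receive.mem_out_of_timeout hlt hm
    obtain ⟨k₂, out₂, hk₂, hnow₂, hrec₂⟩ := E.exists_receives hsync
      (T := T + Δ + d * (M + 2 * Δ) + M + Δ) (by linarith) (by linarith)
      (hrec₁.envelopes_subset
        (show (⟨u, w, m, (E.state k₁).now⟩ : Envelope n Tx) ∈ _ from ⟨rfl, rfl, hw, hout⟩))
      hnow₁
    have hnow := hrec₂.now_eq
    have hle := hrec₂.receive.le_round_of_evidence (hinv.evidence m hm).2
    dsimp only at hle
    exact ⟨k₂ + 1, by omega, by linarith, by omega⟩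

/-- Finitely many monotone events that all happen by time `t` have all happened in one state reached
by time `t`. -/
theorem exists_common_state (hbyz : byz.card ≤ par.f) (hf : 3 * par.f < n) {t : ℝ}
    {p : ℕ → Fin n → Prop} (hp : ∀ v i k, i ≤ k → p i v → p k v)
    (h : ∀ v, v ∉ byz → ∃ i, (E.state i).now ≤ t ∧ p i v) :
    ∃ i, (E.state i).now ≤ t ∧ ∀ v, v ∉ byz → p i v := by
  choose! k hk hpk using h
  have hne : (Finset.univ.filter (· ∉ byz)).Nonempty :=
    Finset.card_pos.1 (by have := card_honest hbyz hf; omega)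
  obtain ⟨w, hw, hmax⟩ := Finset.exists_max_image _ k hne
  simp only [Finset.mem_filter, Finset.mem_univ, true_and] at hw hmax
  exact ⟨k w, hk w hw, fun v hv => hp v _ _ (hmax v hv) (hpk v hv)⟩

/-- During synchrony the highest round of an honest node grows: once all honest nodes have reached
it and stay there, they all send timeout messages for it. -/
theorem exists_next_round (hpos : par.Nonneg) (hbyz : byz.card ≤ par.f) (hf : 3 * par.f < n)
    {Δ a b T M : ℝ} (hΔ : 0 ≤ Δ) (hM : ∀ v, par.roundTimeout v ≤ M)
    (hsync : E.Synchronous Δ a b) (ha : a ≤ T) (hb : T + (n + 1) * (M + 2 * Δ) ≤ b) {j R : ℕ}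
    (hR : ¬ E.Below j R) (hT : (E.state j).now ≤ T) :
    ∃ k, (E.state k).now ≤ T + (n + 1) * (M + 2 * Δ) ∧ ¬ E.Below k (R + 1) := by
  by_contra! hcon
  unfold Below at hR
  push Not at hR
  obtain ⟨u, hu, hR⟩ := hR
  have hexp : T + (n + 1) * (M + 2 * Δ) = T + Δ + n * (M + 2 * Δ) + M + Δ := by ring
  rw [hexp] at hcon hb
  have hM0 : 0 ≤ M := (hpos u).2.trans (hM u)
  have hnn : (0 : ℝ) ≤ n * (M + 2 * Δ) := by positivity
  obtain ⟨K, hK, hall⟩ := exists_common_state (E := E) hbyz hf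
    (t := T + Δ + n * (M + 2 * Δ) + M + Δ)
    (p := fun i v => j ≤ i ∧ (v, R) ∈ ((E.state i).node u).timeouts)
    (fun v i k hik h => ⟨h.1.trans hik, E.timeouts_mono hpos u hik h.2⟩) (fun w hw => by
      obtain ⟨i, hji, hi, hRi⟩ := catch_up hpos hbyz hf hΔ hM hsync ha hu hR hT hw n
        (by linarith)
      have hRi' : ((E.state i).node w).round = R := by
        have := hcon i (by linarith) w hw
        omega
      obtain ⟨k, hik, hk, hlt | hsend⟩ := starts_round_or_times_out (E := E) hpos hw i
      · have := hcon k (by linarith [hM w]) w hw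
        omega
      rw [hRi'] at hsend
      obtain ⟨k₁, out, hk₁, hnow₁, hrec⟩ := E.exists_receives hsync
        (T := T + Δ + n * (M + 2 * Δ) + M) (by linarith) (by linarith) (hsend u hu)
        (by linarith [hM w])
      exact ⟨k₁ + 1, hrec.now_eq.trans_le hnow₁, by omega, hrec.receive.mem_timeouts⟩)
  have hjK := (hall u hu).1
  have hround : ((E.state K).node u).round = R := by
    have h1 := hcon K hK u hu
    have h2 := E.round_mono hpos u hjK
    omega
  refine absurd (((E.inv hpos K).node u hu).few_timeouts R hround.le) (not_lt.2 ?_)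
  refine (card_honest hbyz hf).trans (Finset.card_le_card fun v hv => ?_)
  simp only [Finset.mem_filter, Finset.mem_univ, true_and] at hv
  simpa [NodeState.timeoutIssuers] using (hall v hv).2

theorem exists_later_round (hpos : par.Nonneg) (hbyz : byz.card ≤ par.f) (hf : 3 * par.f < n)
    {Δ a b T M : ℝ} (hΔ : 0 ≤ Δ) (hM0 : 0 ≤ M) (hM : ∀ v, par.roundTimeout v ≤ M)
    (hsync : E.Synchronous Δ a b) (ha : a ≤ T) {j R : ℕ}
    (hR : ¬ E.Below j R) (hT : (E.state j).now ≤ T) (m : ℕ)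
    (hb : T + m * ((n + 1) * (M + 2 * Δ)) ≤ b) :
    ∃ k, (E.state k).now ≤ T + m * ((n + 1) * (M + 2 * Δ)) ∧ ¬ E.Below k (R + m) := by
  induction m with
  | zero => exact ⟨j, by simpa using hT, hR⟩
  | succ m ih =>
    have hstep : (0 : ℝ) ≤ (n + 1) * (M + 2 * Δ) := by positivity
    have hm : (0 : ℝ) ≤ m * ((n + 1) * (M + 2 * Δ)) := by positivity
    push_cast at hb ⊢
    rw [add_mul, one_mul, ← add_assoc] at hb ⊢
    obtain ⟨k, hk, hkR⟩ := ih (by linarith)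
    exact exists_next_round hpos hbyz hf hΔ hM hsync (by linarith) hb hkR hk

/-- Time does not jump by more than a round timeout. -/
theorem exists_state_ge (hpos : par.Nonneg) (hbyz : byz.card ≤ par.f) (hf : 3 * par.f < n)
    {M : ℝ} (hM0 : 0 ≤ M) (hM : ∀ v, par.roundTimeout v ≤ M) {c : ℝ} (hc : 0 ≤ c) :
    ∃ j, c ≤ (E.state j).now ∧ (E.state j).now ≤ c + M := by
  classical
  have hex : ∃ j, c ≤ (E.state j).now := by
    obtain ⟨j, -, hj⟩ := E.exists_now_gt 0 c
    exact ⟨j, hj.le⟩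
  refine ⟨Nat.find hex, Nat.find_spec hex, ?_⟩
  rcases hj : Nat.find hex with _ | j
  · rw [E.start]
    change (0 : ℝ) ≤ c + M
    linarith
  · have hlt : (E.state j).now < c := not_le.1 (Nat.find_min hex (by omega))
    obtain ⟨v, hv⟩ : (Finset.univ.filter (· ∉ byz)).Nonempty :=
      Finset.card_pos.1 (by have := card_honest hbyz hf; omega)
    have hvb : v ∉ byz := by simpa using hv
    rcases E.tick_or_takes hpos j with ⟨-, -, hnode, -⟩ | ⟨w, out, ht⟩
    · have h1 := ((E.inv hpos j).node v hvb).roundDeadline_le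
      have h2 := ((E.inv hpos (j + 1)).node v hvb).le_roundDeadline
      rw [hnode] at h2
      linarith [hM v]
    · rw [ht.now_eq]
      linarith

end Execution

/-! ### Rounds with honest creators -/

theorem LocalStep.canCreateBlock {sent : Set (Msg n Tx)} {v : Fin n} {t : ℝ}
    {s s' : NodeState n Tx} {out : Out n Tx} (h : LocalStep par byz sent v t s s' out)
    (hs : s.CanCreateBlock par) (hr : s'.round = s.round) : s'.CanCreateBlock par := by
  classical
  cases h with
  | learnPermits Q hsub hQ =>
    obtain ⟨hc, P, hP⟩ := hs
    refine ⟨hc, P, hP.trans (Finset.card_le_card fun v hv => ?_)⟩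
    simp only [NodeState.permitters, Finset.mem_filter, Finset.mem_univ, true_and] at hv ⊢
    exact hsub hv
  | learnTimeouts => exact hs
  | giveUp hc ht hb => exact absurd hs hb
  | roundTimeout => exact hs
  | advance T r S out hsT hT hr' => exact absurd hr (Nat.lt_succ_of_le hr').ne'
  | receive res hv hr' => exact absurd hr (Nat.lt_succ_of_le hr').ne'
  | create res hc hv hr' => exact absurd hr (Nat.lt_succ_of_le hr'.ge).ne'

namespace Execution

variable {E : Execution par byz Tx}

/-- If all honest nodes start round `q` by time `X` and none leaves it within `Δ` afterwards, then
its honest creator gets the permits of all of them. -/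
theorem exists_all_permits (hpos : par.Nonneg) (hbyz : byz.card ≤ par.f) (hf : 3 * par.f < n)
    {Δ a b X : ℝ} (hΔ : 0 < Δ) (hsync : E.Synchronous Δ a b) (ha : a ≤ X) (hb : X + Δ ≤ b)
    {j q : ℕ} (hj : E.Below j q) (hc : creator n q ∉ byz)
    (hreach : ∀ w, w ∉ byz → ∃ i, j < i ∧ (E.state i).now ≤ X ∧ q ≤ ((E.state i).node w).round)
    (hcon : ∀ k, (E.state k).now ≤ X + Δ → E.Below k (q + 1)) :
    ∃ K, j ≤ K ∧ (E.state K).now ≤ X + Δ ∧ ((E.state K).node (creator n q)).round = q ∧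
      ∀ w, w ∉ byz → ∃ P, (w, q, P) ∈ ((E.state K).node (creator n q)).permits := by
  obtain ⟨K, hK, hall⟩ := exists_common_state (E := E) hbyz hf (t := X + Δ)
    (p := fun i w => j ≤ i ∧ q ≤ ((E.state i).node w).round ∧
      ∃ P, (w, q, P) ∈ ((E.state i).node (creator n q)).permits)
    (fun v i k hik h => ⟨h.1.trans hik, h.2.1.trans (E.round_mono hpos v hik),
      h.2.2.imp fun P hP => E.permits_mono hpos _ hik hP⟩) (fun w hw => by
      obtain ⟨i, hji, hi, hiq⟩ := hreach w hw
      obtain ⟨k, hjk, hki, hkq, hkq'⟩ := E.exists_start_round (hj w hw) hiq hji.le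
      have hk : (E.state (k + 1)).now ≤ X := (E.now_mono hpos hki).trans hi
      have hround : ((E.state (k + 1)).node w).round = q := by
        have := hcon (k + 1) (by linarith) w hw
        omega
      obtain ⟨hnow, henv, -⟩ := E.starts_round hpos (hkq.trans_le hkq')
      have hP := ((E.inv hpos (k + 1)).node w hw).current_valid
      rw [hround] at henv
      obtain ⟨m, out, hm, hmX, hrec⟩ := E.exists_receives hsync ha hb (henv _ hc rfl)
        (by dsimp only; linarith)
      refine ⟨m + 1, hrec.now_eq.trans_le hmX, by omega, ?_, _, hrec.receive.mem_permits hP⟩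
      exact hkq'.trans (E.round_mono hpos w (by omega)))
  obtain ⟨hjK, hround, -⟩ := hall _ hc
  have := hcon K hK _ hc
  exact ⟨K, hjK, hK, by omega, fun w hw => (hall w hw).2.2⟩

/-- A round with an honest creator that is started by all honest nodes within `Δ` ends within `4Δ`:
at its creator timeout the creator has enough permits for a proposal. -/
theorem exists_end_of_round (hpos : par.Nonneg) (hbyz : byz.card ≤ par.f) (hf : 3 * par.f < n)
    {Δ a b : ℝ} (hΔ : 0 < Δ)
    (hct : ∀ v, 2 * Δ < par.creatorTimeout v ∧ par.creatorTimeout v < 3 * Δ)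
    (hsync : E.Synchronous Δ a b) {j q : ℕ} (ha : a ≤ (E.state j).now)
    (hb : (E.state j).now + 2 * Δ ≤ b) (hj : E.Below j q) (hc : creator n q ∉ byz)
    (hreach : ∀ w, w ∉ byz → ∃ i, j < i ∧ (E.state i).now ≤ (E.state j).now + Δ ∧
      q ≤ ((E.state i).node w).round) :
    ∃ k, (E.state k).now ≤ (E.state j).now + 4 * Δ ∧ ¬ E.Below k (q + 1) := by
  by_contra! hcon
  set t₀ := (E.state j).now with ht₀
  obtain ⟨K, -, hK, -, hall⟩ := exists_all_permits (X := t₀ + Δ) hpos hbyz hf hΔ hsync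
    (by linarith) (by linarith) hj hc hreach fun k hk => hcon k (by linarith)
  obtain ⟨i, hji, hi, hiq⟩ := hreach _ hc
  set u := creator n q with hu
  obtain ⟨hu1, hu2⟩ := hct u
  have hround : ((E.state i).node u).round = q := by
    have := hcon i (by linarith) u hc
    omega
  obtain ⟨-, hd, hcr⟩ := E.timers_of_below hpos hj hji.le hc hiq
  have hd' := ((E.inv hpos i).node u hc).creatorDeadline_le
  replace hcr := (hcr (by rw [hround])).resolve_right (by linarith)
  -- The creator stays in its creator phase, so that time cannot pass its deadline.
  have key : ∀ k, i ≤ k → ((E.state k).node u).creating ∧ ((E.state k).node u).round = q ∧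
      ((E.state k).node u).creatorDeadline = ((E.state i).node u).creatorDeadline := by
    intro k hk
    induction k, hk using Nat.le_induction with
    | base => exact ⟨hcr, hround, rfl⟩
    | succ k hk ih =>
      have hnow := ((E.inv hpos k).node u hc).le_creatorDeadline ih.1
      rw [ih.2.2] at hnow
      rcases E.node_eq_or_takes hpos k u with heq | ⟨out, ht⟩
      · rw [heq]
        exact ih
      have hl := ht.local_step
      have hlt := hcon (k + 1) (by rw [ht.now_eq]; linarith) u hc
      generalize (E.state (k + 1)).node u = s' at hl hlt ⊢
      cases hl with
      | learnPermits => exact ih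
      | learnTimeouts => exact ih
      | roundTimeout => exact ih
      | giveUp hcr hd' _ hfew =>
        rw [ih.2.2] at hd'
        have hKk : K ≤ k := by
          by_contra hlt'
          have := E.now_mono hpos (not_le.1 hlt').le
          linarith
        refine absurd hfew (not_lt.2 ((card_honest hbyz hf).trans
          (Finset.card_le_card fun w hw => ?_)))
        simp only [Finset.mem_filter, Finset.mem_univ, true_and] at hw
        obtain ⟨P, hP⟩ := hall w hw
        rw [ih.2.1]
        simpa [NodeState.allPermitters] using ⟨P, E.permits_mono hpos u hKk hP⟩
      | advance T r S out hsT hT hr =>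
        simp only [NodeState.enter] at hlt
        omega
      | receive res hv hr =>
        simp only [NodeState.accept, NodeState.enter] at hlt
        omega
      | create res hc hv hr =>
        simp only [NodeState.accept, NodeState.enter] at hlt
        omega
  obtain ⟨k, hk, hlt⟩ := E.exists_now_gt i (((E.state i).node u).creatorDeadline)
  have := ((E.inv hpos k).node u hc).le_creatorDeadline (key k hk).1
  rw [(key k hk).2.2] at this
  linarith

/-- If, moreover, all honest permits of the round are for the same position, then it ends within
`2Δ`: time cannot pass while the creator can create a block. -/
theorem exists_end_of_common_round (hpos : par.Nonneg) (hbyz : byz.card ≤ par.f)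
    (hf : 3 * par.f < n) {Δ a b : ℝ} (hΔ : 0 < Δ) (hct : ∀ v, 2 * Δ < par.creatorTimeout v)
    (hsync : E.Synchronous Δ a b) {j q : ℕ} (ha : a ≤ (E.state j).now)
    (hb : (E.state j).now + 2 * Δ ≤ b) (hj : E.Below j q) (hc : creator n q ∉ byz)
    (hreach : ∀ w, w ∉ byz → ∃ i, j < i ∧ (E.state i).now ≤ (E.state j).now + Δ ∧
      q ≤ ((E.state i).node w).round)
    {P : Position n Tx}
    (hP : ∀ k w P', w ∉ byz → .permit w q P' ∈ (E.state k).sent → P' = P) :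
    ∃ k, (E.state k).now ≤ (E.state j).now + 2 * Δ ∧ ¬ E.Below k (q + 1) := by
  by_contra! hcon
  set t₀ := (E.state j).now with ht₀
  obtain ⟨K, hjK, hK, hround, hall⟩ := exists_all_permits (X := t₀ + Δ) hpos hbyz hf hΔ hsync
    (by linarith) (by linarith) hj hc hreach fun k hk => hcon k (by linarith)
  set u := creator n q with hu
  have hcr := ((E.timers_of_below hpos hj hjK hc hround.ge).2.2 (by rw [hround])).resolve_right
    (by linarith [hct u])
  have hcan : ((E.state K).node u).CanCreateBlock par := by
    refine ⟨hcr, P, (card_honest hbyz hf).trans (Finset.card_le_card fun w hw => ?_)⟩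
    simp only [Finset.mem_filter, Finset.mem_univ, true_and] at hw
    obtain ⟨P', hP'⟩ := hall w hw
    have := hP K w P' hw (((E.inv hpos K).node u hc).permits_sent w q P' hP' hw)
    subst this
    rw [hround]
    simpa [NodeState.permitters] using hP'
  have key : ∀ k, K ≤ k → (E.state k).now = (E.state K).now ∧
      ((E.state k).node u).round = q ∧ ((E.state k).node u).CanCreateBlock par := by
    intro k hk
    induction k, hk using Nat.le_induction with
    | base => exact ⟨rfl, hround, hcan⟩
    | succ k hk ih =>
      obtain ⟨hnow, hr, hcan⟩ := ih
      rcases E.tick_or_takes hpos k with ⟨-, hno, -⟩ | ⟨v, out, ht⟩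
      · exact absurd hcan (hno u hc)
      refine ⟨ht.now_eq.trans hnow, ?_⟩
      have hr' : ((E.state (k + 1)).node u).round = q := by
        have h1 := hcon (k + 1) (by rw [ht.now_eq, hnow]; linarith) u hc
        have h2 := E.round_mono hpos u (Nat.le_add_right k 1)
        omega
      refine ⟨hr', ?_⟩
      rcases eq_or_ne u v with huv | huv
      · have hl := ht.local_step
        rw [← huv] at hl
        exact hl.canCreateBlock hcan (hr'.trans hr.symm)
      · rw [ht.node_eq u huv]
        exact hcan
  obtain ⟨k, hk, hlt⟩ := E.exists_now_gt K (E.state K).now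
  exact absurd (key k hk).1 hlt.ne'

theorem eq_of_sent (hpos : par.Nonneg) {res res' : Result n Tx} {k k' : ℕ}
    (h : .result res ∈ (E.state k).sent) (h' : .result res' ∈ (E.state k').sent)
    (hv : res.Valid par.f) (hv' : res'.Valid par.f) (hc : creator n res.round ∉ byz)
    (hr : res.round = res'.round) : res = res' :=
  (E.inv hpos (max k k')).result_unique res res' (E.sent_mono hpos (le_max_left _ _) h)
    (E.sent_mono hpos (le_max_right _ _) h') hv hv' hc hr

theorem permit_zero_notMem_sent (hpos : par.Nonneg) {v : Fin n} (hv : v ∉ byz) {r : ℕ}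
    (hr : 0 < r) {P : Position n Tx} : .permit v r P ∉ (E.state 0).sent := fun h => by
  have := ((E.inv hpos 0).permit_sent v hv r P h).1
  rw [E.state_zero_round v] at this
  omega

/-- After a round `q` with an honest creator that ends with a result before any honest round
timeout, the permits of honest nodes for round `q + 1` are all for the position of that result. -/
theorem permit_position_eq (hpos : par.Nonneg) (hbyz : byz.card ≤ par.f) {D : ℝ}
    (hD : ∀ v, D < par.roundTimeout v) {j q : ℕ} (hj : E.Below j q) (hc : creator n q ∉ byz)
    {res : Result n Tx} (hv : res.Valid par.f) (hq : res.round = q) {i : ℕ}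
    (hsent : .result res ∈ (E.state i).sent)
    (hreach : ∀ w, w ∉ byz → ∃ i, (E.state i).now ≤ (E.state j).now + D ∧
      q + 1 ≤ ((E.state i).node w).round)
    (k : ℕ) {w : Fin n} (hw : w ∉ byz) {P : Position n Tx}
    (h : .permit w (q + 1) P ∈ (E.state k).sent) : P = res.position := by
  induction k with
  | zero => exact absurd h (E.permit_zero_notMem_sent hpos hw (Nat.succ_pos q))
  | succ k ih =>
    by_cases hold : .permit w (q + 1) P ∈ (E.state k).sent
    · exact ih hold
    obtain ⟨hlt, hround, rfl⟩ := E.new_permit hpos h hold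
    obtain ⟨-, -, ⟨res', h'⟩ | ⟨r, S, h'⟩⟩ := E.starts_round hpos hlt
    · have hr : res'.round = q := by have := h'.round_eq; omega
      rw [h'.current_eq, eq_of_sent hpos (h'.sent (hr ▸ hc)) hsent h'.valid hv (hr ▸ hc)
        (hr.trans hq.symm)]
    · obtain rfl : r = q := by have := h'.round_eq; omega
      obtain ⟨m, hm, hmq⟩ := hreach w hw
      have hnow := h'.lt_now E hpos hbyz hD hj le_rfl
      have hmk : m ≤ k := by
        by_contra hlt'
        have := E.now_mono hpos (not_le.1 hlt').le
        linarith
      have := E.round_mono hpos w hmk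
      omega

/-- A result accepted by an honest node confirms the block `B` if it is `B` or if the honest permits
in it confirm `B`. -/
theorem AcceptsResult.confirms (hpos : par.Nonneg) (hbyz : byz.card ≤ par.f) {k : ℕ} {w : Fin n}
    (hw : w ∉ byz) {res : Result n Tx} (h : E.AcceptsResult k w res) {B : Block n Tx}
    (hP : ∀ v, v ∉ byz → ∀ P, .permit v res.round P ∈ (E.state k).sent →
      Confirms (E.acceptedProposals k) B P) :
    Confirms (E.acceptedProposals (k + 1)) B res.position := by
  obtain ⟨q, hq, hqb⟩ := h.valid.exists_honest hbyz
  have hconf := (hP q.1 hqb q.2 (h.support_sent q hq hqb)).mono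
    (E.acceptedProposals_mono hpos (Nat.le_succ k))
  cases res with
  | block b => exact .child b (Finset.mem_singleton_self b) (hq.2 ▸ hconf)
  | proposal p => exact .proposal p ⟨w, hw, h.mem_accepted⟩ q.1 q.2 hq hconf

/-- As long as no honest node leaves a round after that of the block `B` by timeout, all honest
permits of later rounds confirm `B`. -/
theorem confirms_of_permit (hpos : par.Nonneg) (hbyz : byz.card ≤ par.f) {B : Block n Tx}
    (hB : (Result.block B).Valid par.f) (hc : creator n B.round ∉ byz) {i : ℕ}
    (hsent : .result (.block B) ∈ (E.state i).sent) {t : ℝ}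
    (ht : ∀ k v r S, (E.state k).now ≤ t → B.round ≤ r → ¬ E.LeavesByTimeout k v r S)
    (k : ℕ) (hk : (E.state k).now ≤ t) {w : Fin n} (hw : w ∉ byz) {r : ℕ} (hr : B.round < r)
    {P : Position n Tx} (h : .permit w r P ∈ (E.state k).sent) :
    Confirms (E.acceptedProposals k) B P := by
  induction k generalizing w r P with
  | zero => exact absurd h (E.permit_zero_notMem_sent hpos hw (by omega))
  | succ k ih =>
    have hk' : (E.state k).now ≤ t := (E.now_mono hpos (Nat.le_succ k)).trans hk
    by_cases hold : .permit w r P ∈ (E.state k).sent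
    · exact (ih hk' hw hr hold).mono (E.acceptedProposals_mono hpos (Nat.le_succ k))
    obtain ⟨hlt, hround, rfl⟩ := E.new_permit hpos h hold
    obtain ⟨-, -, ⟨res, h'⟩ | ⟨r', S, h'⟩⟩ := E.starts_round hpos hlt
    · rw [h'.current_eq]
      have := h'.round_eq
      rcases (show B.round ≤ res.round by omega).eq_or_lt with heq | hlt'
      · obtain rfl := eq_of_sent hpos (h'.sent (heq ▸ hc)) hsent h'.valid hB (heq ▸ hc) heq.symm
        exact .mem (Finset.mem_singleton_self B)
      · exact h'.confirms hpos hbyz hw fun v hv P hP => ih hk' hv hlt' hP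
    · have := h'.round_eq
      exact absurd h' (ht k w r' S hk' (by omega))

/-- The first honest node starts the second of three successive rounds with honest creators during
synchrony. Then the creator of the third round creates a block, and all honest nodes accept it. -/
theorem exists_accepted_block (hpos : par.Nonneg) (hbyz : byz.card ≤ par.f) (hf : 3 * par.f < n)
    {Δ a b : ℝ} (hΔ : 0 < Δ)
    (hct : ∀ v, 2 * Δ < par.creatorTimeout v ∧ par.creatorTimeout v < 3 * Δ)
    (hrt : ∀ v, 5 * Δ < par.roundTimeout v)
    (hsync : E.Synchronous Δ a b) {j r : ℕ} (ha : a ≤ (E.state j).now)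
    (hb : (E.state j).now + 7 * Δ ≤ b) (hc₀ : creator n r ∉ byz) (hc₁ : creator n (r + 1) ∉ byz)
    (hc₂ : creator n (r + 2) ∉ byz) (hj : E.Below j (r + 1)) (hj' : ¬ E.Below (j + 1) (r + 1)) :
    ∃ k B, j ≤ k ∧ E.CreatesBlock k B ∧ ∀ v, v ∉ byz →
      ∃ m, k ≤ m ∧ (E.state (m + 1)).now ≤ (E.state j).now + 7 * Δ ∧ E.AcceptsBlock m v B := by
  -- Round `r + 1` ends with a result `res`.
  obtain ⟨k, hk, hkr⟩ := exists_end_of_round hpos hbyz hf hΔ hct hsync ha (by linarith) hj hc₁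
    fun w hw => spread hpos hbyz hΔ.le hsync ha (by linarith) hc₀ hj hj' le_rfl hw
  obtain ⟨i, hji, hik, hi, hi'⟩ := E.exists_first hpos
    (show E.Below j (r + 1 + 1) from fun v hv => (hj v hv).trans (Nat.lt_succ_self _)) hkr
  have hnow_i : (E.state i).now ≤ (E.state j).now + 4 * Δ := (E.now_mono hpos hik.le).trans hk
  have hnow_ji := E.now_mono hpos hji
  have hreach : ∀ w, w ∉ byz → ∃ m, i < m ∧ (E.state m).now ≤ (E.state i).now + Δ ∧
      r + 1 + 1 ≤ ((E.state m).node w).round := fun w hw =>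
    spread hpos hbyz hΔ.le hsync (ha.trans hnow_ji) (by linarith) hc₁ hi hi' le_rfl hw
  obtain ⟨res, hval, hround, hsent⟩ : ∃ res : Result n Tx, res.Valid par.f ∧
      res.round = r + 1 ∧ .result res ∈ (E.state (i + 1)).sent := by
    unfold Below at hi'
    push Not at hi'
    obtain ⟨v, hv, hvr⟩ := hi'
    have hround := E.round_eq_of_first hpos hbyz hi hv hvr
    obtain ⟨-, -, ⟨res, h⟩ | ⟨r', S, h⟩⟩ := E.starts_round hpos ((hi v hv).trans_le hvr)
    · have hr : res.round = r + 1 := by have := h.round_eq; omega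
      exact ⟨res, h.valid, hr, h.sent (hr ▸ hc₁)⟩
    · have := h.round_eq
      have := h.lt_now E hpos hbyz hrt hj (by omega)
      linarith
  -- Round `r + 2` ends with a result, which is a block.
  obtain ⟨k₂, hk₂, hkr₂⟩ := exists_end_of_common_round (P := res.position) hpos hbyz hf hΔ
    (fun v => (hct v).1) hsync (ha.trans hnow_ji) (by linarith) hi hc₂ hreach
    fun k w P' hw hP' => permit_position_eq hpos hbyz hrt hj hc₁ hval hround hsent
      (fun w hw => (hreach w hw).imp fun m hm => ⟨by linarith [hm.2.1], hm.2.2⟩) k hw hP'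
  obtain ⟨l, hil, hlk, hl, hl'⟩ := E.exists_first hpos
    (show E.Below i (r + 2 + 1) from fun v hv => (hi v hv).trans (Nat.lt_succ_self _)) hkr₂
  have hnow_l : (E.state l).now ≤ (E.state i).now + 2 * Δ := (E.now_mono hpos hlk.le).trans hk₂
  have hnow_il := E.now_mono hpos hil
  have hleave : ∀ k v r' S, (E.state k).now ≤ (E.state i).now + 5 * Δ → r + 2 ≤ r' →
      ¬ E.LeavesByTimeout k v r' S := fun k v r' S hk hr' h =>
    absurd (h.lt_now E hpos hbyz hrt hi hr') (not_lt.2 hk)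
  obtain ⟨res₂, hval₂, hround₂, hsent₂⟩ : ∃ res : Result n Tx, res.Valid par.f ∧
      res.round = r + 2 ∧ .result res ∈ (E.state (l + 1)).sent := by
    unfold Below at hl'
    push Not at hl'
    obtain ⟨v, hv, hvr⟩ := hl'
    have hround := E.round_eq_of_first hpos hbyz hl hv hvr
    obtain ⟨-, -, ⟨res, h⟩ | ⟨r', S, h⟩⟩ := E.starts_round hpos ((hl v hv).trans_le hvr)
    · have hr : res.round = r + 2 := by have := h.round_eq; omega
      exact ⟨res, h.valid, hr, h.sent (hr ▸ hc₂)⟩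
    · have := h.round_eq
      exact absurd h (hleave l v r' S (by linarith) (by omega))
  have hc : creator n res₂.round ∉ byz := hround₂ ▸ hc₂
  have hnew : .result res₂ ∉ (E.state l).sent := fun hs => by
    have := (E.inv hpos l).result_sent res₂ hs hval₂ hc
    have := hl _ hc
    omega
  have hcreates := E.new_result hpos hval₂ hc hsent₂ hnew
  obtain ⟨B, rfl⟩ : ∃ B, res₂ = .block B := by
    cases res₂ with
    | block B => exact ⟨B, rfl⟩
    | proposal p =>
      have h1 := hcreates.deadline_le p rfl
      have h2 := (E.timers_of_below hpos hi hil hc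
        (by rw [hcreates.round_eq]; exact hround₂.ge)).2.1
      linarith [(hct (creator n (Result.proposal p).round)).1]
  have hBround : B.round = r + 2 := hround₂
  refine ⟨l, B, hji.trans hil, ⟨hc, hval₂.2, hnew, hsent₂⟩, fun w hw => ?_⟩
  -- Everybody receives `B` within `Δ`, and leaves its round by then.
  obtain ⟨m, out, hlm, hm, hrec⟩ := E.exists_receives (T := (E.state l).now) hsync (by linarith)
    (by linarith) (hcreates.transit w hw) le_rfl
  have hmB : r + 2 + 1 ≤ ((E.state (m + 1)).node w).round :=
    hround₂ ▸ hrec.receive.lt_round_of_result hval₂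
  obtain ⟨m', hlm', hmm', hlt, hle⟩ := E.exists_start_round (hl w hw) hmB (by omega)
  have hnow_m' : (E.state (m' + 1)).now ≤ (E.state l).now + Δ :=
    (E.now_mono hpos hmm').trans (hrec.now_eq.trans_le hm)
  refine ⟨m', hlm', by linarith, by omega, ?_⟩
  obtain ⟨hnow, -, ⟨res', h⟩ | ⟨r', S, h⟩⟩ := E.starts_round hpos (hlt.trans_le hle)
  · have := h.round_eq
    refine ⟨res', fun hmem => ?_, h.mem_accepted, ?_⟩
    · have := ((E.inv hpos m').node w hw).accepted_lt res' hmem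
      have := h.round_le
      omega
    · rcases (show B.round ≤ res'.round by omega).eq_or_lt with heq | hlt'
      · exact .inl (eq_of_sent hpos (h.sent (heq ▸ hc)) hsent₂ h.valid hval₂ (heq ▸ hc) heq.symm)
      · refine .inr ⟨hlt', h.confirms hpos hbyz hw fun v hv P hP => ?_⟩
        exact confirms_of_permit hpos hbyz hval₂ hc hsent₂
          (fun k v r' S hk hr' => hleave k v r' S hk (by omega)) m' (by linarith) hv hlt' hP
  · have := h.round_eq
    exact absurd h (hleave m' w r' S (by linarith) (by omega))

end Execution

end PermitBFT

theorem mainTheorem4 {Tx : Type*} (n f : ℕ) [NeZero n] (hf : 3 * f < n)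
    (Δ : ℝ) (creatorTimeout roundTimeout : Fin n → ℝ)
    (hcreator : ∀ v, 2 * Δ < creatorTimeout v ∧ creatorTimeout v < 3 * Δ)
    (hround : ∀ v, 5 * Δ < roundTimeout v) :
    ∃ L : ℝ, 0 < L ∧
      ∀ byz : Finset (Fin n), byz.card ≤ f →
      ∀ E : PermitBFT.Execution ⟨f, creatorTimeout, roundTimeout⟩ byz Tx,
      ∀ a b : ℝ, 0 ≤ a → E.Synchronous Δ a b →
      ∀ c : ℝ, a ≤ c → c + L ≤ b →
        ∃ (k : ℕ) (B : PermitBFT.Block n Tx),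
          c ≤ (E.state k).now ∧ E.CreatesBlock k B ∧
          ∀ v, v ∉ byz → ∃ m, k ≤ m ∧ (E.state (m + 1)).now ≤ c + L ∧ E.AcceptsBlock m v B := by
  have hΔ : 0 < Δ := by linarith [(hcreator 0).1, (hcreator 0).2]
  have hpos : PermitBFT.Params.Nonneg ⟨f, creatorTimeout, roundTimeout⟩ := fun v =>
    ⟨by linarith [(hcreator v).1], by linarith [hround v]⟩
  have hM : ∀ v, roundTimeout v ≤ ∑ w, roundTimeout w := fun v =>
    Finset.single_le_sum (fun w _ => (hpos w).2) (Finset.mem_univ v)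
  set M := ∑ w, roundTimeout w
  have hM0 : 0 ≤ M := (hpos 0).2.trans (hM 0)
  have hstep : 0 ≤ n * ((n + 1) * (M + 2 * Δ)) := by positivity
  refine ⟨M + n * ((n + 1) * (M + 2 * Δ)) + 7 * Δ, by positivity, ?_⟩
  intro byz hbyz E a b ha hsync c hac hcb
  obtain ⟨j, hcj, hjc⟩ := PermitBFT.Execution.exists_state_ge (E := E) hpos hbyz hf hM0 hM
    (ha.trans hac)
  -- `R` is the highest round of an honest node in the first state of the interval.
  obtain ⟨u, hu, hmax⟩ := Finset.exists_max_image (Finset.univ.filter (· ∉ byz))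
    (fun v => ((E.state j).node v).round)
    (Finset.card_pos.1 (by have := PermitBFT.card_honest hbyz hf; omega))
  simp only [Finset.mem_filter, Finset.mem_univ, true_and] at hu hmax
  set R := ((E.state j).node u).round
  obtain ⟨r, hRr, hrR, hc₀, hc₁, hc₂⟩ :=
    PermitBFT.exists_honest_creators (n := n) (byz := byz) (by omega) R
  obtain ⟨k, hk, hkR⟩ := PermitBFT.Execution.exists_later_round (E := E) (R := R) hpos hbyz hf hΔ.le
    hM0 hM hsync (hac.trans hcj) (fun h => lt_irrefl _ (h u hu)) le_rfl n (by linarith)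
  have hj : E.Below j (r + 1) := fun v hv => by
    have := hmax v hv
    omega
  have hk' : ¬ E.Below k (r + 1) := fun h => hkR fun v hv => (h v hv).trans_le (by omega)
  obtain ⟨i, hji, hik, hi, hi'⟩ := E.exists_first hpos hj hk'
  have hnow_i := (E.now_mono hpos hik.le).trans hk
  have hnow_ji := E.now_mono hpos hji
  obtain ⟨l, B, hil, hB, hall⟩ := PermitBFT.Execution.exists_accepted_block hpos hbyz hf hΔ hcreator
    hround hsync (by linarith) (by linarith) hc₀ hc₁ hc₂ hi hi'
  have hnow_il := E.now_mono hpos hil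
  refine ⟨l, B, by linarith, hB, fun v hv => ?_⟩
  obtain ⟨m, hm, hmt, hacc⟩ := hall v hv
  exact ⟨m, hm, by linarith, hacc⟩
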